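/- Let $(\Omega,\mathcal F,\mathbb P)$ be a probability space with a filtration $(\mathcal F_t)_{t\ge 0}$, $T<\infty$, and let $A_1,\dots,A_n\in\mathcal F_T$. Let $P_t=(P_t^1,\dots,P_t^n)$, $0\le t\le T$, be a version of the conditional probabilities $P_t^i=\mathbb P(A_i\mid\mathcal F_t)$ that is progressively measurable on $[0,T)$ and satisfies $P_t^i\in(0,1)$ for $t<T$. For $t\in[0,T)$, the set $\mathcal A(t,T)$ of admissible price processes consists of all progressively measurable $u=(u_s)_{s\in[t,T)}$ with values in $[0,1]^n$. Let $\lambda_i=\lambda_i(P^i,u^i)\in[0,\infty]$ be a rate/intensity function. When $u\in\mathcal A(t,T)$ is used, bets on $A_i$ arrive during $[t,T)$ in one of the following two ways (the same one for all $t$ and $u$). * *Continuous arrivals*: $dQ^{u,i}_s=\lambda_i(P^i_s,u^i_s)\,ds$. * *Poisson arrivals*: $Q^{u,i}$ jumps by one at the points of an adapted simple point process with stochastic intensity $\lambda_i(P^i_s,u^i_s)$ relative to $\mathcal F_s\vee\sigma(A_i)$ (given the history, arrivals of bets on $A_i$ carry no further information on whether $A_i$ occurs). Each bet is charged the price posted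 just before it arrives, that is, $\int u^i\,dQ^{u,i}$ is the integral of a predictable version of $u^i$. Starting at time $t$ with revenue $x\in\mathbb R$ and $q\in\mathbb R^n$ bets taken, the terminal wealth is $$Y_T^u=x+\sum_{i=1}^n\int_t^T u_s^i\,dQ_s^{u,i}-\sum_{i=1}^n \mathbf 1_{A_i}Q_T^{u,i},\qquad Q_t^{u,i}=q_i ,$$ (an infinite liability counts as $-\infty$), the risk-neutral objective is the conditional expectation $J(u)=\mathbb E_t\,Y_T^u$ given $X_t=x$, $Q_t=q$ and the information at time $t$ (described by the expectations $\mathbb E[Y_T^u\mid B]$, $B\in\mathcal F_t$, $\mathbb P(B)>0$), and the value function is $V=\sup_{u\in\mathcal A(t,T)}J(u)$. A process $u^*\in\mathcal A(0,T)$ is called *the optimal price process* if $J(u^*)=V$ for all $t\in[0,T)$, all $x,q$ and all such $B$, and if, for every $t\in[0,T)$, every maximizer in $\mathcal A(t,T)$ (for $B=\Omega$) equals $u^*$ $ds\otimes\mathbb P$-almost everywhere on $[t,T)\times\Omega$. For both arrival models the following holds. (i) If $\lambda_i(p_i,u_i)=\frac{p_i}{1-p_i}\cdot\frac{1-u_i}{u_i}$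 for all $i$, then the optimal price process is $u_t^{i,*}=\sqrt{P_t^i}$, $t\in[0,T)$. If moreover $P_t\equiv p\in(0,1)^n$ for all $t\in[0,T)$, then it is $u_t^{i,*}\equiv\sqrt{p_i}$, and the value function is $$V(t,x,p,q)=x-p\cdot q+(T-t)\sum_{i=1}^n\frac{p_i}{1-p_i}\bigl(1-\sqrt{p_i}\bigr)^2 ,\qquad t\in[0,T).$$ (ii) If $\lambda_i(p_i,u_i)=\frac{\log u_i}{\log p_i}$ for all $i$, then for all $t\in[0,T)$ and all $i$ the equation $r(1+\log r)=P_t^i$ has a unique solution $r$ in $(e^{-1},1)$, and the optimal price process is $u_t^{i,*}=$ this solution. -/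

import Mathlib

open MeasureTheory ProbabilityTheory Set
open scoped NNReal ENNReal

namespace Bookmaking

noncomputable section

/-- Lebesgue measure on the time interval `[a, b)`. -/
def timeMeasure (a b : ℝ≥0) : Measure ℝ≥0 :=
  (Measure.comap ((↑) : ℝ≥0 → ℝ) volume).restrict (Ico a b)

/-- `X` is progressively measurable on the time interval `[a, b)`; its values at other times are
irrelevant. -/
def ProgressiveOn {Ω E : Type*} [mΩ : MeasurableSpace Ω] [TopologicalSpace E] [Zero E]
    (𝓕 : Filtration ℝ≥0 mΩ) (a b : ℝ≥0) (X : ℝ≥0 → Ω → E) : Prop :=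
  IsStronglyProgressive 𝓕 ((Ico a b).indicator X)

/-- A betting market with `n` sets of outcomes on a filtered probability space: a finite horizon
`T`, the filtration, the sets of outcomes `A i` (decided by time `T`), and a progressively
measurable version `P` of the conditional probabilities of the `A i`, which lie in `(0, 1)`
before time `T`. -/
structure BettingMarket {Ω : Type*} [mΩ : MeasurableSpace Ω] (μ : Measure Ω) (n : ℕ) where
  T : ℝ≥0
  filt : Filtration ℝ≥0 mΩ
  A : Fin n → Set Ω
  measurableSet_A : ∀ i, MeasurableSet[filt T] (A i)
  P : ℝ≥0 → Ω → Fin n → ℝ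
  progressive_P : ProgressiveOn filt 0 T P
  P_eq_condExp : ∀ s ≤ T, ∀ i, (fun ω => P s ω i) =ᵐ[μ] μ[(A i).indicator (fun _ => (1 : ℝ)) | filt s]
  P_mem_Ioo : ∀ s < T, ∀ ω i, P s ω i ∈ Ioo (0 : ℝ) 1

/-- A price process: `u s ω i` is the price at time `s` of a bet on the `i`-th set of outcomes. -/
abbrev PricePolicy (Ω : Type*) (n : ℕ) := ℝ≥0 → Ω → Fin n → ℝ

/-- `λ i p u ∈ [0, ∞]`: rate or intensity of bets on the `i`-th set of outcomes, given the vector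
`p` of conditional probabilities and the vector `u` of prices. -/
abbrev RateFunction (n : ℕ) := Fin n → (Fin n → ℝ) → (Fin n → ℝ) → ℝ≥0∞

/-- The rate `(p / (1 - p)) * ((1 - u) / u)`, for `p, u ∈ [0, 1]`, with value `∞` at `u = 0 < p`. -/
def oddsRate (p u : ℝ) : ℝ≥0∞ :=
  (ENNReal.ofReal p / ENNReal.ofReal (1 - p)) * (ENNReal.ofReal (1 - u) / ENNReal.ofReal u)

/-- `- log u ∈ [0, ∞]` for `u ∈ [0, 1]`, with `- log 0 = ∞`. -/
def negLog (u : ℝ) : ℝ≥0∞ :=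
  if u ≤ 0 then ∞ else ENNReal.ofReal (- Real.log u)

/-- The rate `log u / log p`, for `p, u ∈ [0, 1]`, with value `∞` at `u = 0 < p < 1`. -/
def logRate (p u : ℝ) : ℝ≥0∞ :=
  negLog u / negLog p

/-- Expectation of an extended-real random variable, `E[Y⁺] - E[Y⁻]`
(with value `-∞` if `E[Y⁻] = ∞`). -/
def expect {Ω : Type*} [MeasurableSpace Ω] (μ : Measure Ω) (Y : Ω → EReal) : EReal :=
  ((∫⁻ ω, (Y ω).toENNReal ∂μ : ℝ≥0∞) : EReal) - ((∫⁻ ω, (-Y ω).toENNReal ∂μ : ℝ≥0∞) : EReal)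

/-- What the arrivals of bets produce when the price process `u` is used on `[t, T)`:
`revenue t u i` is the revenue collected from bets on the `i`-th set of outcomes during `[t, T)`
(the integral of the price against the arrivals) and `bets t u i` is the number of these bets. -/
structure BetFlow (Ω : Type*) (n : ℕ) where
  revenue : ℝ≥0 → PricePolicy Ω n → Fin n → Ω → ℝ≥0∞
  bets : ℝ≥0 → PricePolicy Ω n → Fin n → Ω → ℝ≥0∞

namespace BettingMarket

variable {Ω : Type*} [mΩ : MeasurableSpace Ω] {μ : Measure Ω} {n : ℕ}

/-- The admissible price processes on `[t, T)`: progressively measurable, with values in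
`[0, 1]ⁿ`. -/
def admissible (M : BettingMarket μ n) (t : ℝ≥0) : Set (PricePolicy Ω n) :=
  {u | ProgressiveOn M.filt t M.T u ∧ ∀ s ∈ Ico t M.T, ∀ ω i, u s ω i ∈ Icc (0 : ℝ) 1}

/-- The filtration `𝓕 s ∨ σ(A i)`: the history together with the information whether the `i`-th
set of outcomes is going to occur. -/
def outcomeFilt (M : BettingMarket μ n) (i : Fin n) : Filtration ℝ≥0 mΩ :=
  M.filt ⊔ Filtration.const ℝ≥0 (MeasurableSpace.generateFrom {M.A i})
    (MeasurableSpace.generateFrom_le (by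
      rintro _ rfl
      exact M.filt.le M.T _ (M.measurableSet_A i)))

/-- Continuous arrivals: bets on the `i`-th set of outcomes arrive at rate `λ i (P s) (u s)`. -/
def ContinuousArrivals (M : BettingMarket μ n) (lam : RateFunction n) (t : ℝ≥0)
    (u : PricePolicy Ω n) (revenue bets : Fin n → Ω → ℝ≥0∞) : Prop :=
  ∀ i ω,
    bets i ω = ∫⁻ s, lam i (M.P s ω) (u s ω) ∂(timeMeasure t M.T) ∧
    revenue i ω =
      ∫⁻ s, ENNReal.ofReal (u s ω i) * lam i (M.P s ω) (u s ω) ∂(timeMeasure t M.T)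

/-- The random measure `N` is an adapted simple point process on `(t, T]`: `N ω S` is the number
of bets that arrive at times in `S`, one at a time. -/
structure IsPointMeasure (M : BettingMarket μ n) (t : ℝ≥0) (N : Kernel Ω ℝ≥0) : Prop where
  sFinite : IsSFiniteKernel N
  integer_valued : ∀ᵐ ω ∂μ, ∀ S, MeasurableSet S → ∃ k : ℕ∞, N ω S = (k : ℝ≥0∞)
  simple : ∀ᵐ ω ∂μ, ∀ s, N ω {s} ≤ 1
  support : ∀ᵐ ω ∂μ, N ω (Ioc t M.T)ᶜ = 0
  adapted : ∀ r, ∀ S ⊆ Iic r, MeasurableSet S → Measurable[M.filt r] fun ω => N ω S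

/-- Poisson arrivals: bets on the `i`-th set of outcomes are the points of a point process `N i`
with stochastic intensity `λ i (P s) (u s)`, that is
`E ∫ C dN = E ∫ C s * λ i (P s) (u s) ds` for all predictable `C ≥ 0`. The intensity is relative
to `𝓕 s ∨ σ(A i)`: given the history, the arrivals of bets carry no additional information on
whether `A i` occurs.
Each bet is charged the price posted just before it arrives: the revenue `∫ u dN` is the
stochastic integral of a predictable version `w` of `u` (it does not depend on the version). -/
def PoissonArrivals (M : BettingMarket μ n) (lam : RateFunction n) (t : ℝ≥0)
    (u : PricePolicy Ω n) (revenue bets : Fin n → Ω → ℝ≥0∞) : Prop :=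
  ∃ (N : Fin n → Kernel Ω ℝ≥0) (w : PricePolicy Ω n),
    (∀ i, M.IsPointMeasure t (N i)) ∧
    (∀ i, ∀ C : ℝ≥0 → Ω → ℝ≥0∞,
      Measurable[(M.outcomeFilt i).predictable] (Function.uncurry C) →
      ∫⁻ ω, ∫⁻ s, C s ω ∂(N i ω) ∂μ =
        ∫⁻ ω, ∫⁻ s, C s ω * lam i (M.P s ω) (u s ω) ∂(timeMeasure t M.T) ∂μ) ∧
    IsStronglyPredictable M.filt w ∧
    (∀ᵐ z ∂((timeMeasure t M.T).prod μ), w z.1 z.2 = u z.1 z.2) ∧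
    (∀ i ω, bets i ω = N i ω (Ioc t M.T) ∧
      revenue i ω = ∫⁻ s in Ioc t M.T, ENNReal.ofReal (w s ω i) ∂(N i ω))

/-- For each starting time and each admissible price process, the flow of bets follows the
continuous arrivals model, or, in all cases, the Poisson arrivals model. -/
def IsBetFlow (M : BettingMarket μ n) (lam : RateFunction n) (F : BetFlow Ω n) : Prop :=
  (∀ t < M.T, ∀ u ∈ M.admissible t,
    M.ContinuousArrivals lam t u (F.revenue t u) (F.bets t u)) ∨
  (∀ t < M.T, ∀ u ∈ M.admissible t,
    M.PoissonArrivals lam t u (F.revenue t u) (F.bets t u))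

/-- Terminal wealth `X_T - ∑ i, 1_{A i} * Q_T i`, after the winning bets are paid, when revenue `x`
and `q i` bets on `A i` have been taken up to time `t` and `u` is used on `[t, T)`. An infinite
liability counts as `-∞`, even if the revenue is infinite too. -/
def terminalWealth (M : BettingMarket μ n) (F : BetFlow Ω n) (t : ℝ≥0) (x : ℝ) (q : Fin n → ℝ)
    (u : PricePolicy Ω n) (ω : Ω) : EReal :=
  ((x : EReal) + ∑ i, (F.revenue t u i ω : EReal)) -
    ∑ i, (M.A i).indicator (fun ω => (q i : EReal) + (F.bets t u i ω : EReal)) ω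

/-- The risk-neutral objective: the expected terminal wealth given `X_t = x`, `Q_t = q` and the
event `B`. With `B` ranging over the events of `𝓕 t` this describes the conditional expectation
given `𝓕 t`. -/
def objective (M : BettingMarket μ n) (F : BetFlow Ω n) (t : ℝ≥0) (x : ℝ) (q : Fin n → ℝ)
    (B : Set Ω) (u : PricePolicy Ω n) : EReal :=
  expect (μ[|B]) (M.terminalWealth F t x q u)

/-- The value function: the supremum of the objective over the admissible price processes. -/
def value (M : BettingMarket μ n) (F : BetFlow Ω n) (t : ℝ≥0) (x : ℝ) (q : Fin n → ℝ)
    (B : Set Ω) : EReal :=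
  ⨆ u ∈ M.admissible t, M.objective F t x q B u

/-- `u` is the optimal price process: it is admissible, it attains the supremum from every time
`t < T`, for all current data, given every event of positive probability known at time `t`; and it
is unique up to null sets of time and chance. -/
structure IsOptimalPrice (M : BettingMarket μ n) (F : BetFlow Ω n) (u : PricePolicy Ω n) :
    Prop where
  admissible : u ∈ M.admissible 0
  optimal : ∀ t < M.T, ∀ (x : ℝ) (q : Fin n → ℝ) (B : Set Ω), MeasurableSet[M.filt t] B →
    μ B ≠ 0 → M.objective F t x q B u = M.value F t x q B
  unique : ∀ t < M.T, ∀ (x : ℝ) (q : Fin n → ℝ), ∀ v ∈ M.admissible t,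
    M.objective F t x q univ v = M.value F t x q univ →
    ∀ᵐ z ∂((timeMeasure t M.T).prod μ), v z.1 z.2 = u z.1 z.2

end BettingMarket

end

end Bookmaking

/-! A bet sold at price `u` earns `u` if its event fails and costs `1 - u` if it occurs. So terminal
wealth is a constant, plus the revenue `R` from losing bets, minus the net payout `D = Q - R` on
winning ones. At time `s` the rate is known, so conditioning on the history replaces the indicator
of `A i` by `P s`. The expected profit then accrues at rate `(1 - p) u λ - p (1 - u) λ = (u - p)
λ(p, u)`. Prices do not influence `P`, so there is nothing dynamic left: the problem separates over
times, scenarios and events into maximizing `(u - p) λ(p, u)` over `u`. If this has a unique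
maximizer `g p`, then `u = g(P)` is optimal. Another optimal policy has a nonnegative deficit with
zero integral, hence agrees with it almost everywhere.

Both arrival models lead to the same three expectation formulas (`FlowLaw`). For Poisson arrivals
this works because the intensity is relative to the filtration enlarged by `A i`, so the indicator
of `A i` may be put into the test process. The reduction to pointwise maximization is
`isOptimalPrice_of_greedy`; the two scalar problems are `isGreedyPrice_oddsRate` and
`isGreedyPrice_logRate`.

Infinities need care, since rates may be infinite. Gain densities are always at most `1`, so gains
are integrable and only losses can be infinite. At the greedy price the rate itself is at most `1`.
Gains and losses are therefore kept apart in `[0, ∞]`. The wealth formula is an upper bound for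
every policy and an equality for the greedy one. -/

namespace Bookmaking

/-! ### The pointwise maximization problem -/

/-- Density of the expected revenue from losing bets. -/
noncomputable def gain (l : ℝ → ℝ → ℝ≥0∞) (p u : ℝ) : ℝ≥0∞ :=
  ENNReal.ofReal (1 - p) * (ENNReal.ofReal u * l p u)

/-- Density of the expected net payout on winning bets. -/
noncomputable def loss (l : ℝ → ℝ → ℝ≥0∞) (p u : ℝ) : ℝ≥0∞ :=
  ENNReal.ofReal p * (ENNReal.ofReal (1 - u) * l p u)

/-- The price `g p` is the unique maximizer of `gain l p - loss l p`, and the quantities at stake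
are bounded where they have to be. -/
structure IsGreedyPrice (l : ℝ → ℝ → ℝ≥0∞) (g : ℝ → ℝ) : Prop where
  measurable_rate : Measurable (Function.uncurry l)
  measurable_price : Measurable g
  mem_Icc : ∀ p ∈ Ioo (0 : ℝ) 1, g p ∈ Icc (0 : ℝ) 1
  rate_le : ∀ p ∈ Ioo (0 : ℝ) 1, l p (g p) ≤ 1
  gain_le : ∀ p ∈ Ioo (0 : ℝ) 1, ∀ u ∈ Icc (0 : ℝ) 1, gain l p u ≤ 1
  le : ∀ p ∈ Ioo (0 : ℝ) 1, ∀ u ∈ Icc (0 : ℝ) 1,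
    gain l p u + loss l p (g p) ≤ gain l p (g p) + loss l p u
  eq_of_eq : ∀ p ∈ Ioo (0 : ℝ) 1, ∀ u ∈ Icc (0 : ℝ) 1,
    gain l p u + loss l p (g p) = gain l p (g p) + loss l p u → u = g p

lemma gain_eq_ofReal {l : ℝ → ℝ → ℝ≥0∞} {p u r : ℝ} (hp : p ∈ Ioo (0 : ℝ) 1)
    (hu : u ∈ Icc (0 : ℝ) 1) (h : l p u = ENNReal.ofReal r) :
    gain l p u = ENNReal.ofReal ((1 - p) * (u * r)) := by
  rw [gain, h, ← ENNReal.ofReal_mul hu.1, ← ENNReal.ofReal_mul (by linarith [hp.2])]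

lemma loss_eq_ofReal {l : ℝ → ℝ → ℝ≥0∞} {p u r : ℝ} (hp : p ∈ Ioo (0 : ℝ) 1)
    (hu : u ∈ Icc (0 : ℝ) 1) (h : l p u = ENNReal.ofReal r) :
    loss l p u = ENNReal.ofReal (p * ((1 - u) * r)) := by
  rw [loss, h, ← ENNReal.ofReal_mul (by linarith [hu.2]), ← ENNReal.ofReal_mul hp.1.le]

/-- Reduction of `IsGreedyPrice` to a maximization problem for a real-valued rate. -/
lemma IsGreedyPrice.of_real {l : ℝ → ℝ → ℝ≥0∞} {g : ℝ → ℝ} (ρ : ℝ → ℝ → ℝ)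
    (hl : Measurable (Function.uncurry l)) (hg : Measurable g)
    (hgm : ∀ p ∈ Ioo (0 : ℝ) 1, g p ∈ Ioc (0 : ℝ) 1)
    (h0 : ∀ p ∈ Ioo (0 : ℝ) 1, l p 0 = ∞)
    (hρ : ∀ p ∈ Ioo (0 : ℝ) 1, ∀ u ∈ Ioc (0 : ℝ) 1, l p u = ENNReal.ofReal (ρ p u))
    (hρ0 : ∀ p ∈ Ioo (0 : ℝ) 1, ∀ u ∈ Ioc (0 : ℝ) 1, 0 ≤ ρ p u)
    (hρg : ∀ p ∈ Ioo (0 : ℝ) 1, ρ p (g p) ≤ 1)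
    (hgain : ∀ p ∈ Ioo (0 : ℝ) 1, ∀ u ∈ Ioc (0 : ℝ) 1, (1 - p) * (u * ρ p u) ≤ 1)
    (hlt : ∀ p ∈ Ioo (0 : ℝ) 1, ∀ u ∈ Ioc (0 : ℝ) 1, u ≠ g p →
      (u - p) * ρ p u < (g p - p) * ρ p (g p)) :
    IsGreedyPrice l g := by
  have key : ∀ p ∈ Ioo (0 : ℝ) 1, ∀ u ∈ Icc (0 : ℝ) 1, u ≠ g p →
      gain l p u + loss l p (g p) < gain l p (g p) + loss l p u := by
    intro p hp u hu hne
    have hg' : g p ∈ Icc (0 : ℝ) 1 := ⟨(hgm p hp).1.le, (hgm p hp).2⟩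
    rw [gain_eq_ofReal hp hg' (hρ p hp _ (hgm p hp)),
      loss_eq_ofReal hp hg' (hρ p hp _ (hgm p hp))]
    have hρg0 := hρ0 p hp _ (hgm p hp)
    have hp1 : 0 ≤ 1 - p := by linarith [hp.2]
    have hg1 : 0 ≤ 1 - g p := by linarith [hg'.2]
    -- At price `0` the rate is infinite: the gain is `0 * ∞ = 0` and the loss is `∞`, so this price
    -- is strictly worse.
    rcases hu.1.eq_or_lt with rfl | hu0
    · have h1 : loss l p 0 = ∞ := by
        rw [loss, h0 p hp]
        simp [ENNReal.mul_top, hp.1]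
      rw [h1, gain]
      simp
    · have hu' : u ∈ Ioc (0 : ℝ) 1 := ⟨hu0, hu.2⟩
      have hρu := hρ0 p hp u hu'
      have hu1 : 0 ≤ 1 - u := by linarith [hu.2]
      have := hlt p hp u hu' hne
      have hp0 := hp.1.le
      have hg0 := hg'.1
      rw [gain_eq_ofReal hp hu (hρ p hp _ hu'), loss_eq_ofReal hp hu (hρ p hp _ hu'),
        ← ENNReal.ofReal_add (by positivity) (by positivity),
        ← ENNReal.ofReal_add (by positivity) (by positivity)]
      -- Gain minus loss is `(u - p) * ρ p u`, so this is `hlt` with all terms moved to their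
      -- positive side.
      have h1 : (1 - p) * (u * ρ p u) + p * ((1 - g p) * ρ p (g p)) <
          (1 - p) * (g p * ρ p (g p)) + p * ((1 - u) * ρ p u) := by linarith
      exact (ENNReal.ofReal_lt_ofReal_iff (lt_of_le_of_lt (by positivity) h1)).2 h1
  refine ⟨hl, hg, fun p hp => ⟨(hgm p hp).1.le, (hgm p hp).2⟩, ?_, ?_, ?_, ?_⟩
  · intro p hp
    rw [hρ p hp _ (hgm p hp)]
    exact ENNReal.ofReal_le_one.2 (hρg p hp)
  · intro p hp u hu
    rcases hu.1.eq_or_lt with rfl | hu0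
    · simp [gain]
    · rw [gain_eq_ofReal hp hu (hρ p hp _ ⟨hu0, hu.2⟩)]
      exact ENNReal.ofReal_le_one.2 (hgain p hp u ⟨hu0, hu.2⟩)
  · intro p hp u hu
    by_cases h : u = g p
    · rw [h]
    · exact (key p hp u hu h).le
  · intro p hp u hu h
    by_contra hne
    exact (key p hp u hu hne).ne h

/-! ### The two rate functions and their maximizers -/

lemma measurable_oddsRate : Measurable (Function.uncurry oddsRate) := by
  unfold oddsRate Function.uncurry
  fun_prop

lemma measurable_negLog : Measurable negLog := by
  unfold negLog
  exact Measurable.ite measurableSet_Iic measurable_const (by fun_prop)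

lemma measurable_logRate : Measurable (Function.uncurry logRate) := by
  unfold logRate Function.uncurry
  exact (measurable_negLog.comp measurable_snd).div (measurable_negLog.comp measurable_fst)

lemma oddsRate_eq_ofReal {p u : ℝ} (hp : p ∈ Ioo (0 : ℝ) 1) (hu : 0 < u) :
    oddsRate p u = ENNReal.ofReal (p / (1 - p) * ((1 - u) / u)) := by
  have h1 : 0 < 1 - p := by linarith [hp.2]
  rw [oddsRate, ← ENNReal.ofReal_div_of_pos h1, ← ENNReal.ofReal_div_of_pos hu,
    ← ENNReal.ofReal_mul (div_nonneg hp.1.le h1.le)]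

lemma logRate_eq_ofReal {p u : ℝ} (hp : p ∈ Ioo (0 : ℝ) 1) (hu : u ∈ Ioc (0 : ℝ) 1) :
    logRate p u = ENNReal.ofReal (Real.log u / Real.log p) := by
  have h1 : Real.log p < 0 := Real.log_neg hp.1 hp.2
  rw [logRate, negLog, negLog, if_neg hp.1.not_ge, if_neg hu.1.not_ge,
    ← ENNReal.ofReal_div_of_pos (by linarith), neg_div_neg_eq]

/-- With `p = r²`, completing the square shows that the profit rate at `u` falls short of the one at
`r` by `p / (1 - p) * (u - r)² / u`. The rate at `r` is `r / (1 + r)`, and the gain density is `p *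
(1 - u)`. -/
lemma isGreedyPrice_oddsRate : IsGreedyPrice oddsRate Real.sqrt := by
  have hs : ∀ p ∈ Ioo (0 : ℝ) 1, 0 < √p ∧ √p < 1 ∧ √p * √p = p := fun p hp =>
    ⟨Real.sqrt_pos.2 hp.1, by rw [Real.sqrt_lt' one_pos]; simpa using hp.2,
      Real.mul_self_sqrt hp.1.le⟩
  refine .of_real (fun p u => p / (1 - p) * ((1 - u) / u)) measurable_oddsRate (by fun_prop)
    (fun p hp => ⟨(hs p hp).1, (hs p hp).2.1.le⟩) ?_
    (fun p hp u hu => oddsRate_eq_ofReal hp hu.1) ?_ ?_ ?_ ?_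
  · intro p hp
    have h1 : ENNReal.ofReal p ≠ 0 := by simpa using hp.1
    simp [oddsRate, ENNReal.mul_top, h1]
  · intro p hp u hu
    have := hp.1; have := hp.2; have := hu.1; have := hu.2
    have h1 : 0 < 1 - p := by linarith
    have h2 : 0 ≤ 1 - u := by linarith
    positivity
  · intro p hp
    obtain ⟨h0, h1, h2⟩ := hs p hp
    generalize √p = r at *
    subst h2
    have h3 : 0 < 1 - r * r := by linarith [hp.2]
    rw [div_mul_div_comm, div_le_one (by positivity)]
    nlinarith [mul_pos h0 (sub_pos.2 h1), mul_pos (mul_pos h0 h0) (sub_pos.2 h1)]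
  · intro p hp u hu
    have h3 : 0 < 1 - p := by linarith [hp.2]
    have : (1 - p) * (u * (p / (1 - p) * ((1 - u) / u))) = p * (1 - u) := by
      have := hu.1.ne'
      field_simp
    rw [this]
    nlinarith [hp.1, hp.2, hu.1, hu.2]
  · intro p hp u hu hne
    obtain ⟨h0, h1, h2⟩ := hs p hp
    generalize √p = r at *
    subst h2
    have h3 : 0 < 1 - r * r := by linarith [hp.2]
    have hu0 := hu.1
    have : (r - r * r) * (r * r / (1 - r * r) * ((1 - r) / r)) -
        (u - r * r) * (r * r / (1 - r * r) * ((1 - u) / u)) =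
        r * r / (1 - r * r) * ((u - r) ^ 2 / u) := by
      field_simp
      ring
    have h4 : 0 < (u - r) ^ 2 := by
      have := sub_ne_zero.2 hne
      positivity
    have : 0 < r * r / (1 - r * r) * ((u - r) ^ 2 / u) := by positivity
    linarith

/-- From `e⁻¹` on, `1 + log r` is nonnegative, and both factors increase. -/
lemma strictMonoOn_mul_one_add_log :
    StrictMonoOn (fun r : ℝ => r * (1 + Real.log r)) (Ici (Real.exp (-1))) := by
  intro r hr s hs hrs
  have hr0 : 0 < r := (Real.exp_pos _).trans_le hr
  have h1 : -1 ≤ Real.log r := by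
    rw [← Real.log_exp (-1)]
    exact Real.log_le_log (Real.exp_pos _) hr
  have h2 : Real.log r < Real.log s := Real.log_lt_log hr0 hrs
  have h3 : 0 < s := hr0.trans hrs
  show r * (1 + Real.log r) < s * (1 + Real.log s)
  nlinarith

/-- Intermediate value theorem: the left side is `0` at `e⁻¹` and `1` at `1`. -/
lemma exists_mul_one_add_log_eq {p : ℝ} (hp : p ∈ Ioo (0 : ℝ) 1) :
    ∃ r ∈ Ioo (Real.exp (-1)) 1, r * (1 + Real.log r) = p := by
  have hc : ContinuousOn (fun r : ℝ => r * (1 + Real.log r)) (Icc (Real.exp (-1)) 1) := by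
    intro r hr
    have : r ≠ 0 := ((Real.exp_pos _).trans_le hr.1).ne'
    fun_prop (disch := assumption)
  have h1 : Real.exp (-1) ≤ 1 := by simp
  have := intermediate_value_Ioo h1 hc
  simpa using this (by simpa using hp)

/-- The solution `r` of `r * (1 + log r) = p` in `(e⁻¹, 1)`, for `p ∈ (0, 1)`. -/
noncomputable def logPrice (p : ℝ) : ℝ :=
  sSup {r | r ∈ Icc (Real.exp (-1)) 1 ∧ r * (1 + Real.log r) ≤ p}

lemma logPrice_eq {p r : ℝ} (hr : r ∈ Ioo (Real.exp (-1)) 1) (h : r * (1 + Real.log r) = p) :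
    logPrice p = r := by
  refine IsGreatest.csSup_eq ⟨⟨⟨hr.1.le, hr.2.le⟩, h.le⟩, fun s hs => ?_⟩
  rw [← h] at hs
  exact (strictMonoOn_mul_one_add_log.le_iff_le hs.1.1 hr.1.le).1 hs.2

/-- Monotonicity supplies Borel measurability of the price. Defining it as a supremum gives this for
all real `p`; where the set is empty the value is the default `0`. -/
lemma monotone_logPrice : Monotone logPrice := by
  intro p q hpq
  have hb : BddAbove {r | r ∈ Icc (Real.exp (-1)) 1 ∧ r * (1 + Real.log r) ≤ q} :=
    ⟨1, fun r hr => hr.1.2⟩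
  rcases {r | r ∈ Icc (Real.exp (-1)) 1 ∧ r * (1 + Real.log r) ≤ p}.eq_empty_or_nonempty with h | h
  · rw [logPrice, h, Real.sSup_empty]
    exact Real.sSup_nonneg fun r hr => (Real.exp_pos _).le.trans hr.1.1
  · exact csSup_le_csSup hb h fun r hr => ⟨hr.1, hr.2.trans hpq⟩

/-- Put `L = log r`, `p = r (1 + L)` and `u = r eᵛ`. Since `log p < 0`, the claim is that `(u - p)
log u - (r - p) L` is positive. It equals `r` times `(1 + L)(eᵛ - 1 - v) + (1 - (1 - v) eᵛ)`. Both
summands are positive by `eˣ > 1 + x` at `x = v` and `x = -v`, together with `L > -1`. -/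
lemma isGreedyPrice_logRate : IsGreedyPrice logRate logPrice := by
  have hs : ∀ p ∈ Ioo (0 : ℝ) 1, ∃ r, 0 < r ∧ r < 1 ∧ -1 < Real.log r ∧ Real.log r < 0 ∧
      logPrice p = r ∧ r * (1 + Real.log r) = p := by
    intro p hp
    obtain ⟨r, hr, h⟩ := exists_mul_one_add_log_eq hp
    have hr0 : 0 < r := (Real.exp_pos _).trans hr.1
    exact ⟨r, hr0, hr.2, (Real.lt_log_iff_exp_lt hr0).2 hr.1, Real.log_neg hr0 hr.2,
      logPrice_eq hr h, h⟩
  refine .of_real (fun p u => Real.log u / Real.log p) measurable_logRate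
    monotone_logPrice.measurable ?_ ?_ (fun p hp u hu => logRate_eq_ofReal hp hu) ?_ ?_ ?_ ?_
  · intro p hp
    obtain ⟨r, h0, h1, -, -, h, -⟩ := hs p hp
    exact h ▸ ⟨h0, h1.le⟩
  · intro p hp
    simp [logRate, negLog, hp.1.not_ge, ENNReal.top_div]
  · intro p hp u hu
    exact div_nonneg_of_nonpos (Real.log_nonpos hu.1.le hu.2) (Real.log_neg hp.1 hp.2).le
  · intro p hp
    obtain ⟨r, h0, h1, -, h2, h, h3⟩ := hs p hp
    rw [h, div_le_one_of_neg (Real.log_neg hp.1 hp.2)]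
    exact Real.log_le_log hp.1 (by nlinarith)
  · intro p hp u hu
    -- The gain is bounded by `1` because `u * (-log u) ≤ 1` and `1 - p ≤ -log p`.
    have h1 := Real.log_le_sub_one_of_pos hp.1
    have h2 := Real.one_sub_inv_le_log_of_pos hu.1
    have h3 : Real.log p < 0 := Real.log_neg hp.1 hp.2
    have h4 := Real.log_nonpos hu.1.le hu.2
    have h5 : u * (-Real.log u) ≤ 1 := by
      have : u * (1 - u⁻¹) ≤ u * Real.log u := mul_le_mul_of_nonneg_left h2 hu.1.le
      rw [mul_sub, mul_inv_cancel₀ hu.1.ne'] at this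
      linarith [hu.1]
    have : (1 - p) * (u * (Real.log u / Real.log p)) =
        (1 - p) * (u * (-Real.log u)) / (-Real.log p) := by
      field_simp
    rw [this, div_le_one (by linarith)]
    nlinarith [hp.2]
  · intro p hp u hu hne
    obtain ⟨r, h0, h1, h2, h3, h, h4⟩ := hs p hp
    rw [h] at hne ⊢
    have hlp : Real.log p < 0 := Real.log_neg hp.1 hp.2
    rw [← mul_div_assoc, ← mul_div_assoc, div_lt_div_right_of_neg hlp, ← h4]
    set v := Real.log u - Real.log r with hv
    have hv0 : v ≠ 0 := fun h => hne (Real.log_injOn_pos hu.1 h0 (sub_eq_zero.1 h))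
    have hur : u = r * Real.exp v := by
      rw [hv, Real.exp_sub, Real.exp_log hu.1, Real.exp_log h0]
      field_simp
    have e1 : v + 1 < Real.exp v := Real.add_one_lt_exp hv0
    have e2 : 0 < 1 - (1 - v) * Real.exp v := by
      have e3 : -v + 1 < Real.exp (-v) := Real.add_one_lt_exp (neg_ne_zero.2 hv0)
      have e4 : Real.exp (-v) * Real.exp v = 1 := by rw [← Real.exp_add]; simp
      nlinarith [Real.exp_pos v]
    have hlu : Real.log u = Real.log r + v := by rw [hv]; ring
    rw [hlu, hur]
    have e5 : 0 < (1 + Real.log r) * (Real.exp v - 1 - v) :=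
      mul_pos (by linarith) (by linarith)
    nlinarith [mul_pos h0 e5, mul_pos h0 e2]

/-! ### Extended-real expectations -/

section Expect

variable {Ω : Type*} [mΩ : MeasurableSpace Ω] {ν : Measure Ω}

lemma expect_mono {Y Z : Ω → EReal} (h : ∀ᵐ ω ∂ν, Y ω ≤ Z ω) : expect ν Y ≤ expect ν Z := by
  refine EReal.sub_le_sub ?_ ?_
  · exact_mod_cast lintegral_mono_ae (h.mono fun ω hω => EReal.toENNReal_le_toENNReal hω)
  · exact_mod_cast lintegral_mono_ae
      (h.mono fun ω hω => EReal.toENNReal_le_toENNReal (EReal.neg_le_neg_iff.2 hω))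

lemma expect_coe {f : Ω → ℝ} (hf : Integrable f ν) :
    expect ν (fun ω => (f ω : EReal)) = ((∫ ω, f ω ∂ν : ℝ) : EReal) := by
  have h1 : ∫⁻ ω, ENNReal.ofReal (f ω) ∂ν ≠ ∞ := hf.lintegral_lt_top.ne
  have h2 : ∫⁻ ω, ENNReal.ofReal (-f ω) ∂ν ≠ ∞ := hf.neg.lintegral_lt_top.ne
  rw [integral_eq_lintegral_pos_part_sub_lintegral_neg_part hf, EReal.coe_sub,
    EReal.coe_ennreal_toReal h1, EReal.coe_ennreal_toReal h2]
  simp only [expect, ← EReal.coe_neg, EReal.toENNReal_of_ne_top (EReal.coe_ne_top _),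
    EReal.toReal_coe]

/-- Expectation of a difference whose positive part is integrable. -/
lemma expect_add_sub {c : Ω → ℝ} {G L : Ω → ℝ≥0∞} (hc : Integrable c ν) (hG : Measurable G)
    (hL : Measurable L) (hGi : ∫⁻ ω, G ω ∂ν ≠ ∞) :
    expect ν (fun ω => (c ω : EReal) + G ω - L ω) =
      ((∫ ω, c ω ∂ν : ℝ) : EReal) + (∫⁻ ω, G ω ∂ν : ℝ≥0∞) - (∫⁻ ω, L ω ∂ν : ℝ≥0∞) := by
  by_cases hLi : ∫⁻ ω, L ω ∂ν = ∞
  -- Pointwise `L ≤ Y⁻ + c⁺ + G` for the integrand `Y`. As `c⁺` and `G` have finite integrals, `Y⁻`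
  -- does not, and both sides are `⊥`.
  · have key : ∫⁻ ω, (-((c ω : EReal) + G ω - L ω)).toENNReal ∂ν = ∞ := by
      have h1 : ∫⁻ ω, ENNReal.ofReal (c ω) ∂ν ≠ ∞ := hc.lintegral_lt_top.ne
      have h2 : ∫⁻ ω, L ω ∂ν ≤ ∫⁻ ω, (-((c ω : EReal) + G ω - L ω)).toENNReal ∂ν +
          (∫⁻ ω, ENNReal.ofReal (c ω) ∂ν + ∫⁻ ω, G ω ∂ν) := by
        rw [← lintegral_add_right _ hG, ← lintegral_add_right' _ (by fun_prop)]
        refine lintegral_mono fun ω => ?_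
        rcases eq_or_ne (G ω) ∞ with hg | hg
        · simp [hg]
        rcases eq_or_ne (L ω) ∞ with hl | hl
        · have : (c ω : EReal) + G ω ≠ ⊥ := by
            simp [EReal.add_eq_bot_iff]
          simp [hl]
        · lift G ω to ℝ≥0 using hg with g
          lift L ω to ℝ≥0 using hl with l
          have : (-((c ω : EReal) + ((g : ℝ≥0∞) : EReal) - ((l : ℝ≥0∞) : EReal))) =
              ((-(c ω + g - l) : ℝ) : EReal) := by
            push_cast
            rfl
          rw [this, EReal.toENNReal_of_ne_top (EReal.coe_ne_top _), EReal.toReal_coe,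
            ← ENNReal.ofReal_coe_nnreal (p := g), ← ENNReal.ofReal_coe_nnreal (p := l)]
          refine le_trans (ENNReal.ofReal_le_ofReal ?_) (ENNReal.ofReal_add_le.trans
            (add_le_add_right ENNReal.ofReal_add_le _))
          linarith
      by_contra h
      rw [hLi, top_le_iff] at h2
      simp [h, h1, hGi] at h2
    rw [expect, key, hLi]
    simp [EReal.sub_top]
  · have hG' : ∀ᵐ ω ∂ν, G ω < ∞ := ae_lt_top hG hGi
    have hL' : ∀ᵐ ω ∂ν, L ω < ∞ := ae_lt_top hL hLi
    have e : expect ν (fun ω => (c ω : EReal) + G ω - L ω) =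
        expect ν (fun ω => ((c ω + (G ω).toReal - (L ω).toReal : ℝ) : EReal)) := by
      have h : ∀ᵐ ω ∂ν, (c ω : EReal) + G ω - L ω =
          ((c ω + (G ω).toReal - (L ω).toReal : ℝ) : EReal) := by
        filter_upwards [hG', hL'] with ω h1 h2
        rw [EReal.coe_sub, EReal.coe_add, EReal.coe_ennreal_toReal h1.ne,
          EReal.coe_ennreal_toReal h2.ne]
      exact le_antisymm (expect_mono (h.mono fun _ h => h.le))
        (expect_mono (h.mono fun _ h => h.ge))
    have iG : Integrable (fun ω => (G ω).toReal) ν :=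
      integrable_toReal_of_lintegral_ne_top hG.aemeasurable hGi
    have iL : Integrable (fun ω => (L ω).toReal) ν :=
      integrable_toReal_of_lintegral_ne_top hL.aemeasurable hLi
    rw [e, expect_coe (f := fun ω => c ω + (G ω).toReal - (L ω).toReal) ((hc.add iG).sub iL),
      integral_sub (f := fun ω => c ω + (G ω).toReal) (hc.add iG) iL, integral_add hc iG,
      integral_toReal hG.aemeasurable hG', integral_toReal hL.aemeasurable hL', EReal.coe_sub,
      EReal.coe_add, EReal.coe_ennreal_toReal hGi, EReal.coe_ennreal_toReal hLi]

end Expect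

/-! ### Rearranging terminal wealth into gains and losses -/

section Wealth

lemma coe_sum_ereal {ι : Type*} (s : Finset ι) (f : ι → ℝ) :
    ((∑ i ∈ s, f i : ℝ) : EReal) = ∑ i ∈ s, (f i : EReal) :=
  map_sum (⟨⟨((↑) : ℝ → EReal), EReal.coe_zero⟩, EReal.coe_add⟩ : ℝ →+ EReal) f s

lemma sum_ereal_ne_bot {ι : Type*} (s : Finset ι) (f : ι → EReal) (h : ∀ i ∈ s, f i ≠ ⊥) :
    ∑ i ∈ s, f i ≠ ⊥ :=
  Finset.sum_induction f (· ≠ ⊥) (fun a b ha hb => by simp [EReal.add_eq_bot_iff, ha, hb])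
    (by simp) h

lemma sum_ereal_eq_top {ι : Type*} [Fintype ι] (f : ι → EReal) (h : ∀ i, f i ≠ ⊥) {i : ι}
    (hi : f i = ⊤) : ∑ i, f i = ⊤ := by
  classical
  rw [← Finset.add_sum_erase _ _ (Finset.mem_univ i), hi]
  exact EReal.top_add_of_ne_bot (sum_ereal_ne_bot _ _ fun j _ => h j)

variable {Ω : Type*} {n : ℕ}

/-- Wealth rearranged: only losing bets contribute gains and only winning bets contribute
losses. -/
lemma wealth_eq (A : Fin n → Set Ω) (x : ℝ) (q : Fin n → ℝ) (R D Q : Fin n → Ω → ℝ≥0∞) (ω : Ω)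
    (hRD : ∀ i, R i ω + D i ω = Q i ω) (hR : ∀ i, (A i)ᶜ.indicator (R i) ω ≠ ∞)
    (hQ : ∀ i, ω ∈ A i → Q i ω ≠ ∞) :
    ((x : EReal) + ∑ i, (R i ω : EReal)) -
        ∑ i, (A i).indicator (fun ω => (q i : EReal) + (Q i ω : EReal)) ω =
      ((x - ∑ i, (A i).indicator (fun _ => q i) ω : ℝ) : EReal) +
        (∑ i, (A i)ᶜ.indicator (R i) ω : ℝ≥0∞) - (∑ i, (A i).indicator (D i) ω : ℝ≥0∞) := by
  classical
  have hRf : ∀ i, R i ω ≠ ∞ := by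
    intro i
    by_cases h : ω ∈ A i
    · intro h'
      exact hQ i h (by rw [← hRD, h', top_add])
    · simpa [h] using hR i
  have e1 : ∀ i, (R i ω : EReal) = ((R i ω).toReal : EReal) := fun i =>
    (EReal.coe_ennreal_toReal (hRf i)).symm
  have e2 : ∀ i, (A i).indicator (fun ω => (q i : EReal) + (Q i ω : EReal)) ω =
      ((if ω ∈ A i then q i + ((R i ω).toReal + (D i ω).toReal) else 0 : ℝ) : EReal) := by
    intro i
    by_cases h : ω ∈ A i
    · have hD : D i ω ≠ ∞ := fun h' => hQ i h (by rw [← hRD, h', add_top])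
      rw [indicator_of_mem h, if_pos h, ← ENNReal.toReal_add (hRf i) hD, hRD, EReal.coe_add,
        EReal.coe_ennreal_toReal (hQ i h)]
    · simp [h]
  have e3 : ((∑ i, (A i)ᶜ.indicator (R i) ω : ℝ≥0∞) : EReal) =
      ((∑ i, if ω ∈ A i then 0 else (R i ω).toReal : ℝ) : EReal) := by
    rw [← EReal.coe_ennreal_toReal (ENNReal.sum_ne_top.2 fun i _ => hR i),
      ENNReal.toReal_sum fun i _ => hR i]
    congr 2
    ext i
    by_cases h : ω ∈ A i <;> simp [h]
  have hDf : ∀ i, (A i).indicator (D i) ω ≠ ∞ := by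
    intro i
    by_cases h : ω ∈ A i
    · simp only [h, indicator_of_mem]
      exact fun h' => hQ i h (by rw [← hRD, h', add_top])
    · simp [h]
  have e4 : ((∑ i, (A i).indicator (D i) ω : ℝ≥0∞) : EReal) =
      ((∑ i, if ω ∈ A i then (D i ω).toReal else 0 : ℝ) : EReal) := by
    rw [← EReal.coe_ennreal_toReal (ENNReal.sum_ne_top.2 fun i _ => hDf i),
      ENNReal.toReal_sum fun i _ => hDf i]
    congr 2
    ext i
    by_cases h : ω ∈ A i <;> simp [h]
  rw [e3, e4]
  simp only [e1, e2]
  rw [← coe_sum_ereal, ← coe_sum_ereal]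
  norm_cast
  rw [sub_add_eq_add_sub, sub_sub, add_sub_assoc, add_sub_assoc]
  congr 1
  rw [← Finset.sum_add_distrib, ← Finset.sum_sub_distrib, ← Finset.sum_sub_distrib]
  refine Finset.sum_congr rfl fun i _ => ?_
  by_cases h : ω ∈ A i <;> simp [h]
  ring

/-- Only an inequality: if the liability on a winning event is infinite, the left side is `⊥` by
convention, while the right side may be finite because `R` can be infinite with `D` finite. -/
lemma wealth_le (A : Fin n → Set Ω) (x : ℝ) (q : Fin n → ℝ) (R D Q : Fin n → Ω → ℝ≥0∞) (ω : Ω)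
    (hRD : ∀ i, R i ω + D i ω = Q i ω) (hR : ∀ i, (A i)ᶜ.indicator (R i) ω ≠ ∞) :
    ((x : EReal) + ∑ i, (R i ω : EReal)) -
        ∑ i, (A i).indicator (fun ω => (q i : EReal) + (Q i ω : EReal)) ω ≤
      ((x - ∑ i, (A i).indicator (fun _ => q i) ω : ℝ) : EReal) +
        (∑ i, (A i)ᶜ.indicator (R i) ω : ℝ≥0∞) - (∑ i, (A i).indicator (D i) ω : ℝ≥0∞) := by
  by_cases hQ : ∀ i, ω ∈ A i → Q i ω ≠ ∞
  · exact (wealth_eq A x q R D Q ω hRD hR hQ).le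
  · push Not at hQ
    obtain ⟨i, hi, hQi⟩ := hQ
    rw [sum_ereal_eq_top (fun i => (A i).indicator (fun ω => (q i : EReal) + (Q i ω : EReal)) ω)
      (i := i), EReal.sub_top]
    · exact bot_le
    · intro j
      by_cases h : ω ∈ A j <;> simp [h, EReal.add_eq_bot_iff]
    · simp [hi, hQi]

variable [mΩ : MeasurableSpace Ω] {ν : Measure Ω} [IsProbabilityMeasure ν]

lemma expect_wealth_aux (A : Fin n → Set Ω) (hA : ∀ i, MeasurableSet (A i)) (x : ℝ)
    (q : Fin n → ℝ) (R D : Fin n → Ω → ℝ≥0∞) (hRm : ∀ i, Measurable (R i))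
    (hDm : ∀ i, Measurable (D i)) (hR : ∀ i, ∫⁻ ω in (A i)ᶜ, R i ω ∂ν ≠ ∞) :
    expect ν (fun ω => ((x - ∑ i, (A i).indicator (fun _ => q i) ω : ℝ) : EReal) +
        (∑ i, (A i)ᶜ.indicator (R i) ω : ℝ≥0∞) - (∑ i, (A i).indicator (D i) ω : ℝ≥0∞)) =
      ((x - ∑ i, ν.real (A i) * q i : ℝ) : EReal) +
        (∑ i, ∫⁻ ω in (A i)ᶜ, R i ω ∂ν : ℝ≥0∞) - (∑ i, ∫⁻ ω in A i, D i ω ∂ν : ℝ≥0∞) := by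
  have m1 : ∀ i, Measurable ((A i)ᶜ.indicator (R i)) := fun i => (hRm i).indicator (hA i).compl
  have m2 : ∀ i, Measurable ((A i).indicator (D i)) := fun i => (hDm i).indicator (hA i)
  have e1 : ∫⁻ ω, ∑ i, (A i)ᶜ.indicator (R i) ω ∂ν = ∑ i, ∫⁻ ω in (A i)ᶜ, R i ω ∂ν := by
    rw [lintegral_finsetSum _ fun i _ => m1 i]
    exact Finset.sum_congr rfl fun i _ => lintegral_indicator (hA i).compl _
  have e2 : ∫⁻ ω, ∑ i, (A i).indicator (D i) ω ∂ν = ∑ i, ∫⁻ ω in A i, D i ω ∂ν := by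
    rw [lintegral_finsetSum _ fun i _ => m2 i]
    exact Finset.sum_congr rfl fun i _ => lintegral_indicator (hA i) _
  have ii : ∀ i, Integrable ((A i).indicator fun _ => q i) ν := fun i =>
    (integrable_const _).indicator (hA i)
  have i1 : Integrable (fun ω => ∑ i, (A i).indicator (fun _ => q i) ω) ν :=
    integrable_finsetSum _ fun i _ => ii i
  rw [expect_add_sub (c := fun ω => x - ∑ i, (A i).indicator (fun _ => q i) ω)
    ((integrable_const x).sub i1) (Finset.measurable_fun_sum _ fun i _ => m1 i)
    (Finset.measurable_fun_sum _ fun i _ => m2 i), e1, e2, integral_sub (integrable_const x) i1,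
    integral_finsetSum _ fun i _ => ii i]
  · simp [integral_indicator_const, hA]
  · rw [e1]
    exact ENNReal.sum_ne_top.2 fun i _ => hR i

lemma expect_wealth_le (A : Fin n → Set Ω) (hA : ∀ i, MeasurableSet (A i)) (x : ℝ)
    (q : Fin n → ℝ) (R D Q : Fin n → Ω → ℝ≥0∞) (hRm : ∀ i, Measurable (R i))
    (hDm : ∀ i, Measurable (D i)) (hRD : ∀ i, ∀ᵐ ω ∂ν, R i ω + D i ω = Q i ω)
    (hR : ∀ i, ∫⁻ ω in (A i)ᶜ, R i ω ∂ν ≠ ∞) :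
    expect ν (fun ω => ((x : EReal) + ∑ i, (R i ω : EReal)) -
        ∑ i, (A i).indicator (fun ω => (q i : EReal) + (Q i ω : EReal)) ω) ≤
      ((x - ∑ i, ν.real (A i) * q i : ℝ) : EReal) +
        (∑ i, ∫⁻ ω in (A i)ᶜ, R i ω ∂ν : ℝ≥0∞) - (∑ i, ∫⁻ ω in A i, D i ω ∂ν : ℝ≥0∞) := by
  rw [← expect_wealth_aux A hA x q R D hRm hDm hR]
  have h : ∀ i, ∀ᵐ ω ∂ν, (A i)ᶜ.indicator (R i) ω < ∞ := fun i =>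
    ae_lt_top ((hRm i).indicator (hA i).compl) (by
      rw [lintegral_indicator (hA i).compl]
      exact hR i)
  refine expect_mono ?_
  filter_upwards [ae_all_iff.2 h, ae_all_iff.2 hRD] with ω h1 h2
  exact wealth_le A x q R D Q ω h2 fun i => (h1 i).ne

/-- A finite expected number of bets rules out infinite liabilities almost surely, so the pointwise
bound becomes an equality. -/
lemma expect_wealth_eq (A : Fin n → Set Ω) (hA : ∀ i, MeasurableSet (A i)) (x : ℝ)
    (q : Fin n → ℝ) (R D Q : Fin n → Ω → ℝ≥0∞) (hRm : ∀ i, Measurable (R i))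
    (hDm : ∀ i, Measurable (D i)) (hRD : ∀ i, ∀ᵐ ω ∂ν, R i ω + D i ω = Q i ω)
    (hQ : ∀ i, ∫⁻ ω, Q i ω ∂ν ≠ ∞) :
    expect ν (fun ω => ((x : EReal) + ∑ i, (R i ω : EReal)) -
        ∑ i, (A i).indicator (fun ω => (q i : EReal) + (Q i ω : EReal)) ω) =
      ((x - ∑ i, ν.real (A i) * q i : ℝ) : EReal) +
        (∑ i, ∫⁻ ω in (A i)ᶜ, R i ω ∂ν : ℝ≥0∞) - (∑ i, ∫⁻ ω in A i, D i ω ∂ν : ℝ≥0∞) := by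
  have hR : ∀ i, ∫⁻ ω in (A i)ᶜ, R i ω ∂ν ≠ ∞ := fun i => ne_top_of_le_ne_top (hQ i)
    ((setLIntegral_le_lintegral _ _).trans
      (lintegral_mono_ae ((hRD i).mono fun ω h => h ▸ le_self_add)))
  rw [← expect_wealth_aux A hA x q R D hRm hDm hR]
  have h : ∀ i, ∀ᵐ ω ∂ν, R i ω + D i ω < ∞ := fun i =>
    ae_lt_top ((hRm i).add (hDm i)) (by rw [lintegral_congr_ae (hRD i)]; exact hQ i)
  have key : ∀ᵐ ω ∂ν, ((x : EReal) + ∑ i, (R i ω : EReal)) -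
        ∑ i, (A i).indicator (fun ω => (q i : EReal) + (Q i ω : EReal)) ω =
      ((x - ∑ i, (A i).indicator (fun _ => q i) ω : ℝ) : EReal) +
        (∑ i, (A i)ᶜ.indicator (R i) ω : ℝ≥0∞) - (∑ i, (A i).indicator (D i) ω : ℝ≥0∞) := by
    filter_upwards [ae_all_iff.2 h, ae_all_iff.2 hRD] with ω h1 h2
    refine wealth_eq A x q R D Q ω h2 (fun i => ?_) fun i _ => h2 i ▸ (h1 i).ne
    exact ((indicator_le_self _ _ _).trans_lt (le_self_add.trans_lt (h1 i))).ne
  exact le_antisymm (expect_mono (key.mono fun _ h => h.le))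
    (expect_mono (key.mono fun _ h => h.ge))

end Wealth

/-! ### Lebesgue measure on the time interval -/

section Time

lemma measurableEmbedding_coe_nnreal : MeasurableEmbedding ((↑) : ℝ≥0 → ℝ) :=
  NNReal.isClosedEmbedding_coe.measurableEmbedding

lemma timeMeasure_univ (a b : ℝ≥0) :
    timeMeasure a b univ = ENNReal.ofReal ((b : ℝ) - a) := by
  have : ((↑) : ℝ≥0 → ℝ) '' Ico a b = Ico (a : ℝ) b := by
    ext x
    constructor
    · rintro ⟨y, hy, rfl⟩
      exact ⟨by exact_mod_cast hy.1, by exact_mod_cast hy.2⟩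
    · intro hx
      exact ⟨⟨x, a.2.trans hx.1⟩, ⟨hx.1, hx.2⟩, rfl⟩
  rw [timeMeasure, Measure.restrict_apply_univ, measurableEmbedding_coe_nnreal.comap_apply, this,
    Real.volume_Ico]

instance isFiniteMeasure_timeMeasure (a b : ℝ≥0) : IsFiniteMeasure (timeMeasure a b) := by
  exact ⟨by rw [timeMeasure_univ]; exact ENNReal.ofReal_lt_top⟩

lemma ae_timeMeasure_mem_Ico (a b : ℝ≥0) : ∀ᵐ s ∂(timeMeasure a b), s ∈ Ico a b :=
  ae_restrict_mem measurableSet_Ico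

/-- Reconciles the interval `[a, b)` of the policies with the intervals `(a, b]` of predictable
rectangles: the point `a` is null. -/
lemma ae_timeMeasure_mem_Ioc (a b : ℝ≥0) : ∀ᵐ s ∂(timeMeasure a b), s ∈ Ioc a b := by
  have h : timeMeasure a b {a} = 0 := by
    refine le_antisymm ((Measure.restrict_apply_le _ _).trans ?_) zero_le
    rw [measurableEmbedding_coe_nnreal.comap_apply]
    simp
  filter_upwards [ae_timeMeasure_mem_Ico a b, compl_mem_ae_iff.2 h] with s h1 h2
  exact ⟨lt_of_le_of_ne h1.1 (Ne.symm h2), h1.2.le⟩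

end Time

/-! ### Progressively measurable processes -/

section Progressive

variable {Ω E : Type*} [mΩ : MeasurableSpace Ω] {𝓕 : Filtration ℝ≥0 mΩ} {a b : ℝ≥0}

lemma ProgressiveOn.mono_left [TopologicalSpace E] [TopologicalSpace.PseudoMetrizableSpace E]
    [Zero E] {X : ℝ≥0 → Ω → E} (hX : ProgressiveOn 𝓕 a b X) {c : ℝ≥0} (hc : a ≤ c) :
    ProgressiveOn 𝓕 c b X := by
  intro j
  have h1 : (fun p : Iic j × Ω => (Ico c b).indicator X p.1 p.2) =
      ((fun p : Iic j × Ω => (p.1 : ℝ≥0)) ⁻¹' Ici c).indicator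
        (fun p : Iic j × Ω => (Ico a b).indicator X p.1 p.2) := by
    ext p
    by_cases h : c ≤ (p.1 : ℝ≥0)
    · by_cases h' : (p.1 : ℝ≥0) < b <;> simp [indicator, h, h', hc.trans h]
    · simp [indicator, h]
  rw [h1]
  refine StronglyMeasurable.indicator (hX j) ?_
  exact (measurable_subtype_coe.comp measurable_fst) measurableSet_Ici

lemma ProgressiveOn.map {n : ℕ} {X Y : ℝ≥0 → Ω → Fin n → ℝ} (hX : ProgressiveOn 𝓕 a b X)
    {g : ℝ → ℝ} (hg : Measurable g)
    (hY : ∀ s ∈ Ico a b, ∀ ω i, Y s ω i = g (X s ω i)) : ProgressiveOn 𝓕 a b Y := by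
  intro j
  -- The indicator is applied again after `g`, since `g 0` need not be `0`.
  have h1 : (fun p : Iic j × Ω => (Ico a b).indicator Y p.1 p.2) =
      ((fun p : Iic j × Ω => (p.1 : ℝ≥0)) ⁻¹' Ico a b).indicator
        (fun p : Iic j × Ω => fun i => g ((Ico a b).indicator X p.1 p.2 i)) := by
    ext p i
    by_cases h : (p.1 : ℝ≥0) ∈ Ico a b
    · simp [indicator, mem_Ico.1 h, hY _ h]
    · have h' : p ∉ (fun p : Iic j × Ω => (p.1 : ℝ≥0)) ⁻¹' Ico a b := h
      rw [indicator_of_notMem h, indicator_of_notMem h', Pi.zero_apply, Pi.zero_apply]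
  rw [h1]
  let _ : MeasurableSpace Ω := 𝓕 j
  have h2 : Measurable (fun p : Iic j × Ω => (Ico a b).indicator X p.1 p.2) := (hX j).measurable
  refine Measurable.stronglyMeasurable (Measurable.indicator ?_ ?_)
  · exact measurable_pi_lambda _ fun i => hg.comp ((measurable_pi_apply i).comp h2)
  · exact (measurable_subtype_coe.comp measurable_fst) measurableSet_Ico

/-- Progressive measurability at time `b` is joint measurability on `[0, b] × Ω`. It is pulled back
along `s ↦ min s b`, and the indicator removes the times from `b` on. -/
lemma ProgressiveOn.measurable_uncurry [TopologicalSpace E]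
    [TopologicalSpace.PseudoMetrizableSpace E] [MeasurableSpace E] [BorelSpace E] [Zero E]
    {X : ℝ≥0 → Ω → E} (hX : ProgressiveOn 𝓕 a b X) :
    Measurable (Function.uncurry ((Ico a b).indicator X)) := by
  have h1 : Measurable (fun p : Iic b × Ω => (Ico a b).indicator X p.1 p.2) :=
    (hX b).measurable.mono (sup_le_sup le_rfl (MeasurableSpace.comap_mono (𝓕.le b))) le_rfl
  have h2 : Measurable (fun z : ℝ≥0 × Ω => ((⟨min z.1 b, mem_Iic.2 (min_le_right _ _)⟩ : Iic b), z.2)) :=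
    ((measurable_fst.min measurable_const).subtype_mk).prodMk measurable_snd
  have h3 : Function.uncurry ((Ico a b).indicator X) =
      ((fun z : ℝ≥0 × Ω => z.1) ⁻¹' Ico a b).indicator
        ((fun p : Iic b × Ω => (Ico a b).indicator X p.1 p.2) ∘
          fun z : ℝ≥0 × Ω => ((⟨min z.1 b, mem_Iic.2 (min_le_right _ _)⟩ : Iic b), z.2)) := by
    ext ⟨s, ω⟩
    by_cases h : s ∈ Ico a b
    · simp [indicator, mem_Ico.1 h, min_eq_left (mem_Ico.1 h).2.le]
    · have h' : (s, ω) ∉ (fun z : ℝ≥0 × Ω => z.1) ⁻¹' Ico a b := h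
      rw [indicator_of_notMem h', Function.uncurry_apply_pair, indicator_of_notMem h,
        Pi.zero_apply]
  rw [h3]
  exact (h1.comp h2).indicator (measurable_fst measurableSet_Ico)

lemma ProgressiveOn.measurable_apply [TopologicalSpace E]
    [TopologicalSpace.PseudoMetrizableSpace E] [MeasurableSpace E] [BorelSpace E] [Zero E]
    {X : ℝ≥0 → Ω → E} (hX : ProgressiveOn 𝓕 a b X) {s : ℝ≥0} (hs : s ∈ Ico a b) :
    Measurable[𝓕 s] (X s) := by
  have := (IsStronglyProgressive.stronglyAdapted hX s).measurable
  rwa [indicator_of_mem hs] at this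

end Progressive

/-! ### Conditional probabilities as densities -/

section CondProb

variable {Ω : Type*} {m mΩ : MeasurableSpace Ω} {μ : Measure Ω} [IsFiniteMeasure μ]

/-- The defining property of conditional expectation, extended from indicators to all nonnegative
`m`-measurable functions by linearity and monotone convergence; no integrability of `g` is needed.
-/
lemma setLIntegral_eq_of_eq_condExp (hm : m ≤ mΩ) {A : Set Ω} (hA : MeasurableSet A) {p : Ω → ℝ}
    (hp : p =ᵐ[μ] μ[A.indicator (fun _ => (1 : ℝ)) | m]) {g : Ω → ℝ≥0∞} (hg : Measurable[m] g) :
    ∫⁻ ω in A, g ω ∂μ = ∫⁻ ω, ENNReal.ofReal (p ω) * g ω ∂μ := by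
  set f : Ω → ℝ := A.indicator (fun _ => (1 : ℝ)) with hf
  have hfi : Integrable f μ := (integrable_const _).indicator hA
  have h0 : 0 ≤ᵐ[μ] μ[f | m] :=
    condExp_nonneg (Filter.Eventually.of_forall fun ω => indicator_nonneg (fun _ _ => zero_le_one) ω)
  have e1 : ∫⁻ ω, ENNReal.ofReal (p ω) * g ω ∂μ =
      ∫⁻ ω, ENNReal.ofReal ((μ[f | m]) ω) * g ω ∂μ :=
    lintegral_congr_ae (hp.mono fun ω h => by dsimp only; rw [h])
  have hme : Measurable (fun ω => ENNReal.ofReal ((μ[f | m]) ω)) :=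
    (stronglyMeasurable_condExp.measurable.mono hm le_rfl).ennreal_ofReal
  rw [e1]
  refine @Measurable.ennreal_induction Ω m
    (fun g => ∫⁻ ω in A, g ω ∂μ = ∫⁻ ω, ENNReal.ofReal ((μ[f | m]) ω) * g ω ∂μ) ?_ ?_ ?_ g hg
  · intro c S hS
    have hS' := hm S hS
    have : ∫⁻ ω in S, ENNReal.ofReal ((μ[f | m]) ω) ∂μ = μ (S ∩ A) := by
      rw [← ofReal_integral_eq_lintegral_ofReal integrable_condExp.integrableOn
        (ae_restrict_of_ae h0), setIntegral_condExp hm hfi hS, hf, setIntegral_indicator hA]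
      simp
    have e2 : (fun ω => ENNReal.ofReal ((μ[f | m]) ω) * S.indicator (fun _ => c) ω) =
        S.indicator fun ω => ENNReal.ofReal ((μ[f | m]) ω) * c := by
      ext ω
      by_cases h : ω ∈ S <;> simp [h]
    rw [lintegral_indicator hS', setLIntegral_const, Measure.restrict_apply hS', e2,
      lintegral_indicator hS', lintegral_mul_const _ hme, this, mul_comm]
  · intro f₁ f₂ _ h₁ h₂ i₁ i₂
    simp only [Pi.add_apply, mul_add]
    rw [lintegral_add_left (h₁.mono hm le_rfl), lintegral_add_left
      (f := fun ω => ENNReal.ofReal ((μ[f | m]) ω) * f₁ ω) (hme.mul (h₁.mono hm le_rfl)), i₁, i₂]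
  · intro f hf hmono ih
    simp only [ENNReal.mul_iSup]
    rw [lintegral_iSup (fun k => (hf k).mono hm le_rfl) hmono, lintegral_iSup]
    · exact iSup_congr ih
    · exact fun k => hme.mul ((hf k).mono hm le_rfl)
    · exact fun i j hij ω => mul_le_mul_right (hmono hij ω) _

lemma one_sub_eq_condExp_compl (hm : m ≤ mΩ) {A : Set Ω} (hA : MeasurableSet A) {p : Ω → ℝ}
    (hp : p =ᵐ[μ] μ[A.indicator (fun _ => (1 : ℝ)) | m]) :
    (fun ω => 1 - p ω) =ᵐ[μ] μ[Aᶜ.indicator (fun _ => (1 : ℝ)) | m] := by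
  have h1 : Aᶜ.indicator (fun _ => (1 : ℝ)) = (fun _ => (1 : ℝ)) - A.indicator fun _ => (1 : ℝ) :=
    indicator_compl _ _
  have h2 := condExp_sub (μ := μ) (m := m) (integrable_const (1 : ℝ))
    ((integrable_const (1 : ℝ)).indicator hA)
  rw [h1]
  filter_upwards [hp, h2] with ω h3 h4
  rw [h4, Pi.sub_apply, condExp_const hm, h3]

end CondProb

/-! ### Replacing outcomes by their conditional probabilities -/

namespace BettingMarket

variable {Ω : Type*} [mΩ : MeasurableSpace Ω] {μ : Measure Ω} {n : ℕ}
  (M : BettingMarket μ n)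

lemma measurableSet_outcome (i : Fin n) : MeasurableSet (M.A i) :=
  M.filt.le _ _ (M.measurableSet_A i)

lemma cond_restrict (B S : Set Ω) (hS : MeasurableSet S) :
    (μ[|B]).restrict S = (μ B)⁻¹ • μ.restrict (S ∩ B) := by
  rw [ProbabilityTheory.cond, Measure.restrict_smul, Measure.restrict_restrict hS]

/-- The indicator of `B` is known at time `s` and can be absorbed into `g`. -/
lemma setLIntegral_outcome [IsProbabilityMeasure μ] {s : ℝ≥0} (hs : s ≤ M.T) {B : Set Ω}
    (hB : MeasurableSet[M.filt s] B) (i : Fin n) {g : Ω → ℝ≥0∞} (hg : Measurable[M.filt s] g) :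
    ∫⁻ ω in M.A i, g ω ∂μ[|B] = ∫⁻ ω, ENNReal.ofReal (M.P s ω i) * g ω ∂μ[|B] ∧
    ∫⁻ ω in (M.A i)ᶜ, g ω ∂μ[|B] = ∫⁻ ω, ENNReal.ofReal (1 - M.P s ω i) * g ω ∂μ[|B] := by
  have hB' := M.filt.le s _ hB
  have hA := M.measurableSet_outcome i
  have hp := M.P_eq_condExp s hs i
  have key : ∀ A : Set Ω, MeasurableSet A → ∀ p : Ω → ℝ,
      p =ᵐ[μ] μ[A.indicator (fun _ => (1 : ℝ)) | M.filt s] →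
      ∫⁻ ω in A, g ω ∂μ[|B] = ∫⁻ ω, ENNReal.ofReal (p ω) * g ω ∂μ[|B] := by
    intro A hA p hp
    have h := setLIntegral_eq_of_eq_condExp (M.filt.le s) hA hp (hg.indicator hB)
    rw [setLIntegral_indicator hB', inter_comm] at h
    have e2 : (fun ω => ENNReal.ofReal (p ω) * B.indicator g ω) =
        B.indicator fun ω => ENNReal.ofReal (p ω) * g ω := by
      ext ω
      by_cases h : ω ∈ B <;> simp [h]
    rw [e2, lintegral_indicator hB'] at h
    rw [cond_restrict B A hA, lintegral_smul_measure, h, ProbabilityTheory.cond, lintegral_smul_measure]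
  exact ⟨key _ hA _ hp, key _ hA.compl _ (one_sub_eq_condExp_compl (M.filt.le s) hA hp)⟩

variable {M} {t : ℝ≥0} {u : PricePolicy Ω n}

lemma measurable_P_uncurry (M : BettingMarket μ n) (i : Fin n) :
    Measurable fun z : ℝ≥0 × Ω => (Ico 0 M.T).indicator M.P z.1 z.2 i :=
  (measurable_pi_apply i).comp M.progressive_P.measurable_uncurry

/-- Functions of the current probabilities and prices agree, before time `T`, with jointly
measurable functions. -/
lemma exists_measurable_rate (hu : u ∈ M.admissible t) {φ : ℝ → ℝ → ℝ≥0∞}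
    (hφ : Measurable (Function.uncurry φ)) (i : Fin n) :
    ∃ H : ℝ≥0 × Ω → ℝ≥0∞, Measurable H ∧
      ∀ s ∈ Ico t M.T, ∀ ω, H (s, ω) = φ (M.P s ω i) (u s ω i) := by
  refine ⟨fun z => φ ((Ico 0 M.T).indicator M.P z.1 z.2 i) ((Ico t M.T).indicator u z.1 z.2 i),
    hφ.comp ((M.measurable_P_uncurry i).prodMk
      ((measurable_pi_apply i).comp hu.1.measurable_uncurry)), fun s hs ω => ?_⟩
  have hs' : s ∈ Ico 0 M.T := ⟨zero_le, hs.2⟩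
  simp only [indicator_of_mem hs, indicator_of_mem hs']

lemma measurable_lintegral_rate (hu : u ∈ M.admissible t) {φ : ℝ → ℝ → ℝ≥0∞}
    (hφ : Measurable (Function.uncurry φ)) (i : Fin n) :
    Measurable fun ω => ∫⁻ s, φ (M.P s ω i) (u s ω i) ∂(timeMeasure t M.T) := by
  obtain ⟨H, hH, h⟩ := exists_measurable_rate hu hφ i
  have : (fun ω => ∫⁻ s, φ (M.P s ω i) (u s ω i) ∂(timeMeasure t M.T)) =
      fun ω => ∫⁻ s, H (s, ω) ∂(timeMeasure t M.T) := by
    ext ω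
    exact lintegral_congr_ae ((ae_timeMeasure_mem_Ico _ _).mono fun s hs => (h s hs ω).symm)
  rw [this]
  exact hH.lintegral_prod_left'

lemma lintegral_rate_swap (hu : u ∈ M.admissible t) {φ : ℝ → ℝ → ℝ≥0∞}
    (hφ : Measurable (Function.uncurry φ)) (i : Fin n) (ν : Measure Ω) [SFinite ν] :
    ∫⁻ ω, ∫⁻ s, φ (M.P s ω i) (u s ω i) ∂(timeMeasure t M.T) ∂ν =
      ∫⁻ s, ∫⁻ ω, φ (M.P s ω i) (u s ω i) ∂ν ∂(timeMeasure t M.T) := by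
  obtain ⟨H, hH, h⟩ := exists_measurable_rate hu hφ i
  have e1 : ∀ ω, ∫⁻ s, φ (M.P s ω i) (u s ω i) ∂(timeMeasure t M.T) =
      ∫⁻ s, H (s, ω) ∂(timeMeasure t M.T) := fun ω =>
    lintegral_congr_ae ((ae_timeMeasure_mem_Ico _ _).mono fun s hs => (h s hs ω).symm)
  have e2 : ∫⁻ s, ∫⁻ ω, φ (M.P s ω i) (u s ω i) ∂ν ∂(timeMeasure t M.T) =
      ∫⁻ s, ∫⁻ ω, H (s, ω) ∂ν ∂(timeMeasure t M.T) :=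
    lintegral_congr_ae ((ae_timeMeasure_mem_Ico _ _).mono fun s hs => by simp only [h s hs])
  simp_rw [e1, e2]
  rw [lintegral_lintegral_swap]
  exact (hH.comp measurable_swap).aemeasurable

/-- By Tonelli it suffices to argue at a fixed time `s`. There the integrand is known, so `A i` may
be replaced by its conditional probability. -/
lemma setLIntegral_rate [IsProbabilityMeasure μ] (hu : u ∈ M.admissible t) {φ : ℝ → ℝ → ℝ≥0∞}
    (hφ : Measurable (Function.uncurry φ)) (i : Fin n) {B : Set Ω}
    (hB : MeasurableSet[M.filt t] B) :
    ∫⁻ ω in M.A i, ∫⁻ s, φ (M.P s ω i) (u s ω i) ∂(timeMeasure t M.T) ∂μ[|B] =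
      ∫⁻ ω, ∫⁻ s, ENNReal.ofReal (M.P s ω i) * φ (M.P s ω i) (u s ω i)
        ∂(timeMeasure t M.T) ∂μ[|B] ∧
    ∫⁻ ω in (M.A i)ᶜ, ∫⁻ s, φ (M.P s ω i) (u s ω i) ∂(timeMeasure t M.T) ∂μ[|B] =
      ∫⁻ ω, ∫⁻ s, ENNReal.ofReal (1 - M.P s ω i) * φ (M.P s ω i) (u s ω i)
        ∂(timeMeasure t M.T) ∂μ[|B] := by
  have key : ∀ s ∈ Ico t M.T, Measurable[M.filt s] fun ω => φ (M.P s ω i) (u s ω i) := by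
    intro s hs
    have h1 := M.progressive_P.measurable_apply (s := s) ⟨zero_le, hs.2⟩
    have h2 := hu.1.measurable_apply hs
    exact hφ.comp (((measurable_pi_apply i).comp h1).prodMk ((measurable_pi_apply i).comp h2))
  have m1 : Measurable (Function.uncurry fun p u => ENNReal.ofReal p * φ p u) :=
    measurable_fst.ennreal_ofReal.mul hφ
  have m2 : Measurable (Function.uncurry fun p u => ENNReal.ofReal (1 - p) * φ p u) :=
    (measurable_const.sub measurable_fst).ennreal_ofReal.mul hφ
  rw [lintegral_rate_swap hu hφ, lintegral_rate_swap hu hφ, lintegral_rate_swap hu m1,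
    lintegral_rate_swap hu m2]
  constructor
  · refine lintegral_congr_ae ((ae_timeMeasure_mem_Ico _ _).mono fun s hs => ?_)
    exact (M.setLIntegral_outcome hs.2.le (M.filt.mono hs.1 _ hB) i (key s hs)).1
  · refine lintegral_congr_ae ((ae_timeMeasure_mem_Ico _ _).mono fun s hs => ?_)
    exact (M.setLIntegral_outcome hs.2.le (M.filt.mono hs.1 _ hB) i (key s hs)).2

end BettingMarket

/-! ### Predictable σ-algebras -/

section Predictable

variable {Ω : Type*} [mΩ : MeasurableSpace Ω]

lemma predictable_mono {𝓕 𝓖 : Filtration ℝ≥0 mΩ} (h : 𝓕 ≤ 𝓖) : 𝓕.predictable ≤ 𝓖.predictable :=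
  measurableSpace_le_predictable_of_measurableSet
    (fun A hA => measurableSet_predictable_singleton_bot_prod (h ⊥ A hA))
    (fun i A hA => measurableSet_predictable_Ioi_prod (h i A hA))

lemma predictable_le_prod (𝓕 : Filtration ℝ≥0 mΩ) : 𝓕.predictable ≤ Prod.instMeasurableSpace :=
  measurableSpace_le_predictable_of_measurableSet
    (fun A hA => (measurableSet_singleton _).prod (𝓕.le _ A hA))
    (fun i A hA => measurableSet_Ioi.prod (𝓕.le i A hA))

end Predictable

/-! ### The common law of both arrival models -/

namespace BettingMarket

variable {Ω : Type*} [mΩ : MeasurableSpace Ω] {μ : Measure Ω} {n : ℕ}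
  {M : BettingMarket μ n} {t : ℝ≥0} {u : PricePolicy Ω n}

lemma filt_le_outcomeFilt (M : BettingMarket μ n) (i : Fin n) : M.filt ≤ M.outcomeFilt i :=
  le_sup_left

lemma measurableSet_outcomeFilt (M : BettingMarket μ n) (i : Fin n) (s : ℝ≥0) :
    MeasurableSet[M.outcomeFilt i s] (M.A i) :=
  (le_sup_right : _ ≤ M.filt s ⊔ MeasurableSpace.generateFrom {M.A i}) _
    (MeasurableSpace.measurableSet_generateFrom rfl)

/-- What both arrival models have in common: the net payouts `D` on winning bets complement the
revenue, and the expectations of the revenue from losing bets, of the net payouts on winning bets,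
and of the number of bets are given by the rate. -/
structure FlowLaw (M : BettingMarket μ n) (l : ℝ → ℝ → ℝ≥0∞) (t : ℝ≥0) (u : PricePolicy Ω n)
    (R D Q : Fin n → Ω → ℝ≥0∞) : Prop where
  measurable_R : ∀ i, Measurable (R i)
  measurable_D : ∀ i, Measurable (D i)
  add_eq : ∀ i, ∀ᵐ ω ∂μ, R i ω + D i ω = Q i ω
  gain_eq : ∀ B, MeasurableSet[M.filt t] B → ∀ i, ∫⁻ ω in (M.A i)ᶜ, R i ω ∂μ[|B] =
    ∫⁻ ω, ∫⁻ s, gain l (M.P s ω i) (u s ω i) ∂(timeMeasure t M.T) ∂μ[|B]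
  loss_eq : ∀ B, MeasurableSet[M.filt t] B → ∀ i, ∫⁻ ω in M.A i, D i ω ∂μ[|B] =
    ∫⁻ ω, ∫⁻ s, loss l (M.P s ω i) (u s ω i) ∂(timeMeasure t M.T) ∂μ[|B]
  bets_eq : ∀ B, MeasurableSet[M.filt t] B → ∀ i, ∫⁻ ω, Q i ω ∂μ[|B] =
    ∫⁻ ω, ∫⁻ s, l (M.P s ω i) (u s ω i) ∂(timeMeasure t M.T) ∂μ[|B]

lemma ofReal_add_ofReal_one_sub {u : ℝ} (hu : u ∈ Icc (0 : ℝ) 1) :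
    ENNReal.ofReal u + ENNReal.ofReal (1 - u) = 1 := by
  rw [← ENNReal.ofReal_add hu.1 (by linarith [hu.2])]
  simp

lemma aemeasurable_rate (hu : u ∈ M.admissible t) {φ : ℝ → ℝ → ℝ≥0∞}
    (hφ : Measurable (Function.uncurry φ)) (i : Fin n) (ω : Ω) :
    AEMeasurable (fun s => φ (M.P s ω i) (u s ω i)) (timeMeasure t M.T) := by
  obtain ⟨H, hH, h⟩ := exists_measurable_rate hu hφ i
  exact ⟨fun s => H (s, ω), hH.comp measurable_prodMk_right,
    (ae_timeMeasure_mem_Ico _ _).mono fun s hs => (h s hs ω).symm⟩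

variable {l : ℝ → ℝ → ℝ≥0∞}

lemma measurable_mul_rate (hl : Measurable (Function.uncurry l)) :
    Measurable (Function.uncurry fun p u => ENNReal.ofReal u * l p u) :=
  measurable_snd.ennreal_ofReal.mul hl

lemma measurable_one_sub_mul_rate (hl : Measurable (Function.uncurry l)) :
    Measurable (Function.uncurry fun p u => ENNReal.ofReal (1 - u) * l p u) :=
  (measurable_const.sub measurable_snd).ennreal_ofReal.mul hl

lemma ContinuousArrivals.exists_flowLaw [IsProbabilityMeasure μ] {R Q : Fin n → Ω → ℝ≥0∞}
    (hl : Measurable (Function.uncurry l)) (hu : u ∈ M.admissible t)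
    (h : M.ContinuousArrivals (fun i p u => l (p i) (u i)) t u R Q) :
    ∃ D, M.FlowLaw l t u R D Q := by
  have hQ : ∀ i, Q i = fun ω => ∫⁻ s, l (M.P s ω i) (u s ω i) ∂(timeMeasure t M.T) :=
    fun i => funext fun ω => (h i ω).1
  have hR : ∀ i, R i = fun ω =>
      ∫⁻ s, ENNReal.ofReal (u s ω i) * l (M.P s ω i) (u s ω i) ∂(timeMeasure t M.T) :=
    fun i => funext fun ω => (h i ω).2
  refine ⟨fun i ω => ∫⁻ s, ENNReal.ofReal (1 - u s ω i) * l (M.P s ω i) (u s ω i)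
    ∂(timeMeasure t M.T), fun i => ?_, fun i => ?_, fun i => ?_, fun B hB i => ?_,
    fun B hB i => ?_, fun B hB i => ?_⟩
  · rw [hR]
    exact measurable_lintegral_rate hu (measurable_mul_rate hl) i
  · exact measurable_lintegral_rate hu (measurable_one_sub_mul_rate hl) i
  · refine Filter.Eventually.of_forall fun ω => ?_
    rw [hR, hQ, ← lintegral_add_left' (aemeasurable_rate hu (measurable_mul_rate hl) i ω)]
    refine lintegral_congr_ae ((ae_timeMeasure_mem_Ico _ _).mono fun s hs => ?_)
    dsimp only
    rw [← add_mul, ofReal_add_ofReal_one_sub (hu.2 s hs ω i), one_mul]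
  · rw [hR]
    exact (setLIntegral_rate hu (measurable_mul_rate hl) i hB).2
  · exact (setLIntegral_rate hu (measurable_one_sub_mul_rate hl) i hB).1
  · rw [hQ]

/-- The intensity property of a point process, localized in time and to an event known at the
start. -/
lemma setLIntegral_kernel_eq {i : Fin n} {N : Kernel Ω ℝ≥0}
    (hN : ∀ C : ℝ≥0 → Ω → ℝ≥0∞, Measurable[(M.outcomeFilt i).predictable] (Function.uncurry C) →
      ∫⁻ ω, ∫⁻ s, C s ω ∂(N ω) ∂μ =
        ∫⁻ ω, ∫⁻ s, C s ω * l (M.P s ω i) (u s ω i) ∂(timeMeasure t M.T) ∂μ)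
    {C : ℝ≥0 → Ω → ℝ≥0∞} (hC : Measurable[(M.outcomeFilt i).predictable] (Function.uncurry C))
    {S : Set Ω} (hS : MeasurableSet[M.outcomeFilt i t] S) :
    ∫⁻ ω in S, ∫⁻ s in Ioc t M.T, C s ω ∂(N ω) ∂μ =
      ∫⁻ ω in S, ∫⁻ s, C s ω * l (M.P s ω i) (u s ω i) ∂(timeMeasure t M.T) ∂μ := by
  have hS' : MeasurableSet S := (M.outcomeFilt i).le t _ hS
  -- Restricting a predictable process to `(t, T] × S` keeps it predictable because `S` is known at
  -- time `t`.
  have hCS : Measurable[(M.outcomeFilt i).predictable]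
      ((Ioc t M.T ×ˢ S).indicator (Function.uncurry C)) :=
    Measurable.indicator hC (measurableSet_predictable_Ioc_prod t M.T hS)
  have h := hN (fun s ω => (Ioc t M.T ×ˢ S).indicator (Function.uncurry C) (s, ω)) hCS
  have e1 : ∀ ω, ∫⁻ s, (Ioc t M.T ×ˢ S).indicator (Function.uncurry C) (s, ω) ∂(N ω) =
      S.indicator (fun ω => ∫⁻ s in Ioc t M.T, C s ω ∂(N ω)) ω := by
    intro ω
    by_cases hω : ω ∈ S
    · rw [indicator_of_mem hω, ← lintegral_indicator measurableSet_Ioc]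
      refine lintegral_congr fun s => ?_
      by_cases hs : s ∈ Ioc t M.T
      · rw [indicator_of_mem hs, indicator_of_mem (mk_mem_prod hs hω), Function.uncurry_apply_pair]
      · rw [indicator_of_notMem hs, indicator_of_notMem fun h => hs h.1]
    · rw [indicator_of_notMem hω]
      refine (lintegral_congr fun s => ?_).trans lintegral_zero
      exact indicator_of_notMem (fun h => hω h.2) _
  have e2 : ∀ ω, ∫⁻ s, (Ioc t M.T ×ˢ S).indicator (Function.uncurry C) (s, ω) *
        l (M.P s ω i) (u s ω i) ∂(timeMeasure t M.T) =
      S.indicator (fun ω => ∫⁻ s, C s ω * l (M.P s ω i) (u s ω i) ∂(timeMeasure t M.T)) ω := by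
    intro ω
    by_cases hω : ω ∈ S
    · rw [indicator_of_mem hω]
      refine lintegral_congr_ae ((ae_timeMeasure_mem_Ioc _ _).mono fun s hs => ?_)
      dsimp only
      rw [indicator_of_mem (mk_mem_prod hs hω), Function.uncurry_apply_pair]
    · rw [indicator_of_notMem hω]
      refine (lintegral_congr fun s => ?_).trans lintegral_zero
      rw [indicator_of_notMem (fun h => hω h.2), zero_mul]
  simp_rw [e1, e2] at h
  rwa [lintegral_indicator hS', lintegral_indicator hS'] at h

/-- The intensity property is tested with `f(w)` on `(t, T] × S`, where `S` may involve `A i`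
because the intensity is relative to `outcomeFilt`. This turns integrals against the arrivals into
those of the continuous model, also on the winning and losing sets separately. -/
lemma PoissonArrivals.exists_flowLaw [IsProbabilityMeasure μ] {R Q : Fin n → Ω → ℝ≥0∞}
    (hl : Measurable (Function.uncurry l)) (hu : u ∈ M.admissible t)
    (h : M.PoissonArrivals (fun i p u => l (p i) (u i)) t u R Q) :
    ∃ D, M.FlowLaw l t u R D Q := by
  obtain ⟨N, w, hN, hint, hw, hwu, hRQ⟩ := h
  have hsf := fun i => (hN i).sFinite
  have hQ : ∀ i, Q i = fun ω => ∫⁻ _s in Ioc t M.T, 1 ∂(N i ω) :=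
    fun i => funext fun ω => by rw [(hRQ i ω).1, setLIntegral_one]
  have hR : ∀ i, R i = fun ω => ∫⁻ s in Ioc t M.T, ENNReal.ofReal (w s ω i) ∂(N i ω) :=
    fun i => funext fun ω => (hRQ i ω).2
  have hwp : ∀ i, Measurable[M.filt.predictable] fun z : ℝ≥0 × Ω => w z.1 z.2 i := fun i =>
    (measurable_pi_apply i).comp hw.measurable
  have hwo : ∀ i, Measurable[(M.outcomeFilt i).predictable] fun z : ℝ≥0 × Ω => w z.1 z.2 i :=
    fun i => (hwp i).mono (predictable_mono (M.filt_le_outcomeFilt i)) le_rfl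
  have hwm : ∀ i, Measurable fun z : ℝ≥0 × Ω => w z.1 z.2 i :=
    fun i => (hwp i).mono (predictable_le_prod _) le_rfl
  have hwu' : ∀ᵐ ω ∂μ, ∀ᵐ s ∂(timeMeasure t M.T), w s ω = u s ω := by
    have h1 : ∀ᵐ z ∂(μ.prod (timeMeasure t M.T)), w z.2 z.1 = u z.2 z.1 :=
      Measure.measurePreserving_swap.quasiMeasurePreserving.ae hwu
    exact Measure.ae_ae_of_ae_prod h1
  have hmeas : ∀ i, ∀ f : ℝ → ℝ≥0∞, Measurable f →
      Measurable fun ω => ∫⁻ s in Ioc t M.T, f (w s ω i) ∂(N i ω) := by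
    intro i f hf
    have h1 : Measurable (Function.uncurry fun (ω : Ω) (s : ℝ≥0) =>
        (Ioc t M.T).indicator (fun s => f (w s ω i)) s) := by
      have h2 : (Function.uncurry fun (ω : Ω) (s : ℝ≥0) =>
          (Ioc t M.T).indicator (fun s => f (w s ω i)) s) =
          (Prod.snd ⁻¹' Ioc t M.T).indicator fun z : Ω × ℝ≥0 => f (w z.2 z.1 i) := rfl
      rw [h2]
      exact ((hf.comp (hwm i)).comp measurable_swap).indicator (measurable_snd measurableSet_Ioc)
    simp_rw [← lintegral_indicator measurableSet_Ioc]
    exact h1.lintegral_kernel_prod_right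
  have hkey : ∀ i, ∀ f : ℝ → ℝ≥0∞, Measurable f → ∀ S, MeasurableSet[M.outcomeFilt i t] S →
      ∫⁻ ω in S, ∫⁻ s in Ioc t M.T, f (w s ω i) ∂(N i ω) ∂μ =
        ∫⁻ ω in S, ∫⁻ s, f (u s ω i) * l (M.P s ω i) (u s ω i) ∂(timeMeasure t M.T) ∂μ := by
    intro i f hf S hS
    rw [setLIntegral_kernel_eq (hint i) (C := fun s ω => f (w s ω i)) (hf.comp (hwo i)) hS]
    refine lintegral_congr_ae (ae_restrict_of_ae (hwu'.mono fun ω h => ?_))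
    exact lintegral_congr_ae (h.mono fun s hs => by dsimp only; rw [hs])
  have hcond : ∀ i, ∀ f : ℝ → ℝ≥0∞, Measurable f → ∀ B, MeasurableSet[M.filt t] B → ∀ S,
      MeasurableSet[M.outcomeFilt i t] S →
      ∫⁻ ω in S, ∫⁻ s in Ioc t M.T, f (w s ω i) ∂(N i ω) ∂μ[|B] =
        ∫⁻ ω in S, ∫⁻ s, f (u s ω i) * l (M.P s ω i) (u s ω i) ∂(timeMeasure t M.T) ∂μ[|B] := by
    intro i f hf B hB S hS
    rw [cond_restrict B S ((M.outcomeFilt i).le t _ hS), lintegral_smul_measure,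
      lintegral_smul_measure, hkey i f hf _
        (@MeasurableSet.inter _ (M.outcomeFilt i t) _ _ hS (M.filt_le_outcomeFilt i t _ hB))]
  -- The version `w` agrees with `u` only for almost every time, which says nothing directly about
  -- the arrival times. Testing the intensity property with the indicator of `w ∉ [0, 1]` shows that
  -- almost surely no bet is charged a price outside `[0, 1]`.
  have hmem : ∀ i, ∀ᵐ ω ∂μ, ∀ᵐ s ∂((N i ω).restrict (Ioc t M.T)), w s ω i ∈ Icc (0 : ℝ) 1 := by
    intro i
    have hf : Measurable ((Icc (0 : ℝ) 1)ᶜ.indicator fun _ => (1 : ℝ≥0∞)) :=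
      measurable_const.indicator measurableSet_Icc.compl
    have h1 := hkey i _ hf univ MeasurableSet.univ
    have h2 : ∀ ω, ∫⁻ s, (Icc (0 : ℝ) 1)ᶜ.indicator (fun _ => (1 : ℝ≥0∞)) (u s ω i) *
        l (M.P s ω i) (u s ω i) ∂(timeMeasure t M.T) = 0 := by
      intro ω
      rw [← lintegral_zero (μ := timeMeasure t M.T)]
      refine lintegral_congr_ae ((ae_timeMeasure_mem_Ico _ _).mono fun s hs => ?_)
      dsimp only
      rw [indicator_of_notMem (not_not.2 (hu.2 s hs ω i)), zero_mul]
    simp_rw [h2, lintegral_zero] at h1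
    rw [Measure.restrict_univ, lintegral_eq_zero_iff (hmeas i _ hf)] at h1
    filter_upwards [h1] with ω h3
    have h4 : Measurable fun s => w s ω i := (hwm i).comp measurable_prodMk_right
    have h7 : Measurable fun s => (Icc (0 : ℝ) 1)ᶜ.indicator (fun _ => (1 : ℝ≥0∞)) (w s ω i) :=
      hf.comp h4
    rw [Pi.zero_apply, lintegral_eq_zero_iff h7] at h3
    filter_upwards [h3] with s h5
    by_contra h6
    simp only [Pi.zero_apply, indicator_of_mem (mem_compl h6)] at h5
    exact one_ne_zero h5
  refine ⟨fun i ω => ∫⁻ s in Ioc t M.T, ENNReal.ofReal (1 - w s ω i) ∂(N i ω), fun i => ?_,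
    fun i => ?_, fun i => ?_, fun B hB i => ?_, fun B hB i => ?_, fun B hB i => ?_⟩
  · rw [hR]
    exact hmeas i _ ENNReal.measurable_ofReal
  · exact hmeas i (fun x => ENNReal.ofReal (1 - x)) (by fun_prop)
  · filter_upwards [hmem i] with ω h
    have h4 : Measurable fun s => w s ω i := (hwm i).comp measurable_prodMk_right
    rw [hR, hQ, ← lintegral_add_left h4.ennreal_ofReal]
    exact lintegral_congr_ae (h.mono fun s hs => ofReal_add_ofReal_one_sub hs)
  · rw [hR, hcond i _ ENNReal.measurable_ofReal B hB _
      (@MeasurableSet.compl _ _ (M.outcomeFilt i t) (M.measurableSet_outcomeFilt i t))]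
    exact (setLIntegral_rate hu (measurable_mul_rate hl) i hB).2
  · rw [hcond i (fun x => ENNReal.ofReal (1 - x)) (by fun_prop) B hB _
      (M.measurableSet_outcomeFilt i t)]
    exact (setLIntegral_rate hu (measurable_one_sub_mul_rate hl) i hB).1
  · rw [hQ]
    simpa using hcond i (fun _ => 1) measurable_const B hB univ MeasurableSet.univ

lemma IsBetFlow.exists_flowLaw [IsProbabilityMeasure μ] {F : BetFlow Ω n}
    (hF : M.IsBetFlow (fun i p u => l (p i) (u i)) F) (hl : Measurable (Function.uncurry l))
    (ht : t < M.T) (hu : u ∈ M.admissible t) :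
    ∃ D, M.FlowLaw l t u (F.revenue t u) D (F.bets t u) := by
  rcases hF with h | h
  · exact (h t ht u hu).exists_flowLaw hl hu
  · exact (h t ht u hu).exists_flowLaw hl hu

end BettingMarket

/-! ### Comparison of policies and optimality -/

lemma eq_of_sum_le_sum {ι : Type*} [Fintype ι] {f h : ι → ℝ≥0∞} (hfh : ∀ i, f i ≤ h i)
    (hf : ∑ i, f i ≠ ∞) (hs : ∑ i, h i ≤ ∑ i, f i) (i : ι) : f i = h i := by
  classical
  refine le_antisymm (hfh i) ?_
  rw [← Finset.add_sum_erase _ h (Finset.mem_univ i),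
    ← Finset.add_sum_erase _ f (Finset.mem_univ i)] at hs
  have h1 : ∑ j ∈ Finset.univ.erase i, h j ≠ ∞ := by
    refine ne_top_of_le_ne_top ?_ (le_add_self.trans hs)
    rwa [Finset.add_sum_erase _ f (Finset.mem_univ i)]
  refine (ENNReal.add_le_add_iff_right h1).1 (hs.trans ?_)
  gcongr
  exact hfh _

/-- Turns a comparison of profits into one of sums, which stays meaningful in `[0, ∞]`; the loss `L`
may be infinite. -/
lemma ereal_add_sub_le_iff {c : ℝ} {G L G' L' : ℝ≥0∞} (hG : G ≠ ∞) (hG' : G' ≠ ∞) (hL' : L' ≠ ∞) :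
    (c : EReal) + G - L ≤ (c : EReal) + G' - L' ↔ G + L' ≤ G' + L := by
  lift G to ℝ≥0 using hG
  lift G' to ℝ≥0 using hG'
  lift L' to ℝ≥0 using hL'
  rcases eq_or_ne L ∞ with rfl | hL
  · simp [EReal.sub_top]
  lift L to ℝ≥0 using hL
  have e : ∀ a b : ℝ≥0, (c : EReal) + ((a : ℝ≥0∞) : EReal) - ((b : ℝ≥0∞) : EReal) =
      ((c + a - b : ℝ) : EReal) := fun _ _ => rfl
  rw [e, e, EReal.coe_le_coe_iff]
  norm_cast
  rw [← NNReal.coe_le_coe]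
  push_cast
  constructor <;> intro h <;> linarith

namespace BettingMarket

variable {Ω : Type*} [mΩ : MeasurableSpace Ω] {μ : Measure Ω} {n : ℕ}
  {M : BettingMarket μ n} {t : ℝ≥0} {u v : PricePolicy Ω n} {l : ℝ → ℝ → ℝ≥0∞} {g : ℝ → ℝ}

/-- The total over `[t, T)`, in expectation under `ν`, of a function `φ` of the conditional
probability and the price of the `i`-th set of outcomes. -/
noncomputable def total (M : BettingMarket μ n) (t : ℝ≥0) (ν : Measure Ω) (φ : ℝ → ℝ → ℝ≥0∞)
    (u : PricePolicy Ω n) (i : Fin n) : ℝ≥0∞ :=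
  ∫⁻ z, φ (M.P z.1 z.2 i) (u z.1 z.2 i) ∂((timeMeasure t M.T).prod ν)

lemma ae_prod_mem_Ico (a b : ℝ≥0) (ν : Measure Ω) [SFinite ν] :
    ∀ᵐ z ∂((timeMeasure a b).prod ν), z.1 ∈ Ico a b :=
  Measure.quasiMeasurePreserving_fst.ae (ae_timeMeasure_mem_Ico a b)

lemma aemeasurable_rate_prod (hu : u ∈ M.admissible t) {φ : ℝ → ℝ → ℝ≥0∞}
    (hφ : Measurable (Function.uncurry φ)) (i : Fin n) (ν : Measure Ω) [SFinite ν] :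
    AEMeasurable (fun z => φ (M.P z.1 z.2 i) (u z.1 z.2 i)) ((timeMeasure t M.T).prod ν) := by
  obtain ⟨H, hH, h⟩ := exists_measurable_rate hu hφ i
  exact ⟨H, hH, (ae_prod_mem_Ico _ _ _).mono fun z hz => (h z.1 hz z.2).symm⟩

lemma lintegral_lintegral_rate (hu : u ∈ M.admissible t) {φ : ℝ → ℝ → ℝ≥0∞}
    (hφ : Measurable (Function.uncurry φ)) (i : Fin n) (ν : Measure Ω) [SFinite ν] :
    ∫⁻ ω, ∫⁻ s, φ (M.P s ω i) (u s ω i) ∂(timeMeasure t M.T) ∂ν = M.total t ν φ u i := by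
  rw [lintegral_rate_swap hu hφ, total, lintegral_prod _ (aemeasurable_rate_prod hu hφ i ν)]

lemma total_ne_top (ν : Measure Ω) [IsFiniteMeasure ν] {φ : ℝ → ℝ → ℝ≥0∞} {i : Fin n}
    (h : ∀ s ∈ Ico t M.T, ∀ ω, φ (M.P s ω i) (u s ω i) ≤ 1) : M.total t ν φ u i ≠ ∞ := by
  have h1 : M.total t ν φ u i ≤ ∫⁻ _, 1 ∂((timeMeasure t M.T).prod ν) :=
    lintegral_mono_ae ((ae_prod_mem_Ico _ _ _).mono fun z hz => h z.1 hz z.2)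
  refine ne_top_of_le_ne_top ?_ h1
  rw [lintegral_one]
  exact measure_ne_top _ _

lemma measurable_gain (hl : Measurable (Function.uncurry l)) :
    Measurable (Function.uncurry (gain l)) :=
  (measurable_const.sub measurable_fst).ennreal_ofReal.mul (measurable_mul_rate hl)

lemma measurable_loss (hl : Measurable (Function.uncurry l)) :
    Measurable (Function.uncurry (loss l)) :=
  measurable_fst.ennreal_ofReal.mul (measurable_one_sub_mul_rate hl)

lemma admissible_mono (hu : u ∈ M.admissible 0) (t : ℝ≥0) : u ∈ M.admissible t :=
  ⟨hu.1.mono_left zero_le, fun s hs => hu.2 s ⟨zero_le, hs.2⟩⟩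

lemma greedy_admissible (hg : IsGreedyPrice l g)
    (hu : ∀ s < M.T, ∀ ω i, u s ω i = g (M.P s ω i)) : u ∈ M.admissible 0 := by
  refine ⟨M.progressive_P.map hg.measurable_price fun s hs => hu s hs.2, fun s hs ω i => ?_⟩
  rw [hu s hs.2]
  exact hg.mem_Icc _ (M.P_mem_Ioo s hs.2 ω i)

lemma total_gain_ne_top (hg : IsGreedyPrice l g) (hu : u ∈ M.admissible t) (ν : Measure Ω)
    [IsFiniteMeasure ν] (i : Fin n) : M.total t ν (gain l) u i ≠ ∞ :=
  total_ne_top ν fun s hs ω => hg.gain_le _ (M.P_mem_Ioo s hs.2 ω i) _ (hu.2 s hs ω i)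

lemma total_rate_ne_top (hg : IsGreedyPrice l g)
    (hu : ∀ s < M.T, ∀ ω i, u s ω i = g (M.P s ω i)) (ν : Measure Ω) [IsFiniteMeasure ν]
    (i : Fin n) : M.total t ν l u i ≠ ∞ :=
  total_ne_top ν fun s hs ω => by
    rw [hu s hs.2]
    exact hg.rate_le _ (M.P_mem_Ioo s hs.2 ω i)

lemma total_loss_ne_top (hg : IsGreedyPrice l g)
    (hu : ∀ s < M.T, ∀ ω i, u s ω i = g (M.P s ω i)) (ν : Measure Ω) [IsFiniteMeasure ν]
    (i : Fin n) : M.total t ν (loss l) u i ≠ ∞ :=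
  total_ne_top ν fun s hs ω => by
    have h := M.P_mem_Ioo s hs.2 ω i
    have h1 := (hg.mem_Icc _ h).1
    rw [hu s hs.2, loss]
    exact mul_le_one' (ENNReal.ofReal_le_one.2 h.2.le)
      (mul_le_one' (ENNReal.ofReal_le_one.2 (by linarith)) (hg.rate_le _ h))

section Objective

variable [IsProbabilityMeasure μ] {F : BetFlow Ω n}

lemma objective_le (hF : M.IsBetFlow (fun i p u => l (p i) (u i)) F) (hg : IsGreedyPrice l g)
    (ht : t < M.T) (hu : u ∈ M.admissible t) (x : ℝ) (q : Fin n → ℝ) {B : Set Ω}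
    (hB : MeasurableSet[M.filt t] B) (hB0 : μ B ≠ 0) :
    M.objective F t x q B u ≤ ((x - ∑ i, (μ[|B]).real (M.A i) * q i : ℝ) : EReal) +
      (∑ i, M.total t (μ[|B]) (gain l) u i : ℝ≥0∞) -
      (∑ i, M.total t (μ[|B]) (loss l) u i : ℝ≥0∞) := by
  have := cond_isProbabilityMeasure hB0
  obtain ⟨D, hD⟩ := hF.exists_flowLaw hg.measurable_rate ht hu
  have e1 : ∀ i, ∫⁻ ω in (M.A i)ᶜ, F.revenue t u i ω ∂μ[|B] = M.total t (μ[|B]) (gain l) u i :=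
    fun i => (hD.gain_eq B hB i).trans
      (lintegral_lintegral_rate hu (measurable_gain hg.measurable_rate) i _)
  have e2 : ∀ i, ∫⁻ ω in M.A i, D i ω ∂μ[|B] = M.total t (μ[|B]) (loss l) u i :=
    fun i => (hD.loss_eq B hB i).trans
      (lintegral_lintegral_rate hu (measurable_loss hg.measurable_rate) i _)
  simp_rw [← e1, ← e2]
  refine expect_wealth_le M.A M.measurableSet_outcome x q _ _ _ hD.measurable_R hD.measurable_D
    (fun i => cond_absolutelyContinuous.ae_le (hD.add_eq i)) fun i => ?_
  rw [e1]
  exact total_gain_ne_top hg hu _ i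

lemma objective_greedy (hF : M.IsBetFlow (fun i p u => l (p i) (u i)) F)
    (hg : IsGreedyPrice l g) (ht : t < M.T) (hu : ∀ s < M.T, ∀ ω i, u s ω i = g (M.P s ω i))
    (x : ℝ) (q : Fin n → ℝ) {B : Set Ω} (hB : MeasurableSet[M.filt t] B) (hB0 : μ B ≠ 0) :
    M.objective F t x q B u = ((x - ∑ i, (μ[|B]).real (M.A i) * q i : ℝ) : EReal) +
      (∑ i, M.total t (μ[|B]) (gain l) u i : ℝ≥0∞) -
      (∑ i, M.total t (μ[|B]) (loss l) u i : ℝ≥0∞) := by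
  have := cond_isProbabilityMeasure hB0
  have hut := admissible_mono (greedy_admissible hg hu) t
  obtain ⟨D, hD⟩ := hF.exists_flowLaw hg.measurable_rate ht hut
  have e1 : ∀ i, ∫⁻ ω in (M.A i)ᶜ, F.revenue t u i ω ∂μ[|B] = M.total t (μ[|B]) (gain l) u i :=
    fun i => (hD.gain_eq B hB i).trans
      (lintegral_lintegral_rate hut (measurable_gain hg.measurable_rate) i _)
  have e2 : ∀ i, ∫⁻ ω in M.A i, D i ω ∂μ[|B] = M.total t (μ[|B]) (loss l) u i :=
    fun i => (hD.loss_eq B hB i).trans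
      (lintegral_lintegral_rate hut (measurable_loss hg.measurable_rate) i _)
  simp_rw [← e1, ← e2]
  refine expect_wealth_eq M.A M.measurableSet_outcome x q _ _ _ hD.measurable_R hD.measurable_D
    (fun i => cond_absolutelyContinuous.ae_le (hD.add_eq i)) fun i => ?_
  rw [hD.bets_eq B hB i, lintegral_lintegral_rate hut hg.measurable_rate]
  exact total_rate_ne_top hg hu _ i

end Objective

/-- Two policies are compared through the gain of one plus the loss of the other, which avoids
subtraction in `[0, ∞]`. -/
lemma lintegral_gain_add_loss (hl : Measurable (Function.uncurry l)) (hu : u ∈ M.admissible t)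
    (v : PricePolicy Ω n) (ν : Measure Ω) [SFinite ν] (i : Fin n) :
    ∫⁻ z, (gain l (M.P z.1 z.2 i) (u z.1 z.2 i) + loss l (M.P z.1 z.2 i) (v z.1 z.2 i))
      ∂((timeMeasure t M.T).prod ν) = M.total t ν (gain l) u i + M.total t ν (loss l) v i :=
  lintegral_add_left' (aemeasurable_rate_prod hu (measurable_gain hl) i ν) _

lemma ae_gain_add_loss_le (hg : IsGreedyPrice l g)
    (hu : ∀ s < M.T, ∀ ω i, u s ω i = g (M.P s ω i)) (hv : v ∈ M.admissible t) (ν : Measure Ω)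
    [SFinite ν] (i : Fin n) :
    ∀ᵐ z ∂((timeMeasure t M.T).prod ν),
      gain l (M.P z.1 z.2 i) (v z.1 z.2 i) + loss l (M.P z.1 z.2 i) (u z.1 z.2 i) ≤
        gain l (M.P z.1 z.2 i) (u z.1 z.2 i) + loss l (M.P z.1 z.2 i) (v z.1 z.2 i) := by
  filter_upwards [ae_prod_mem_Ico t M.T ν] with z hz
  rw [hu _ hz.2]
  exact hg.le _ (M.P_mem_Ioo _ hz.2 _ i) _ (hv.2 _ hz _ i)

lemma total_gain_add_loss_le (hg : IsGreedyPrice l g)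
    (hu : ∀ s < M.T, ∀ ω i, u s ω i = g (M.P s ω i)) (hv : v ∈ M.admissible t) (ν : Measure Ω)
    [SFinite ν] (i : Fin n) :
    M.total t ν (gain l) v i + M.total t ν (loss l) u i ≤
      M.total t ν (gain l) u i + M.total t ν (loss l) v i := by
  have hut := admissible_mono (greedy_admissible hg hu) t
  rw [← lintegral_gain_add_loss hg.measurable_rate hv u,
    ← lintegral_gain_add_loss hg.measurable_rate hut v]
  exact lintegral_mono_ae (ae_gain_add_loss_le hg hu hv ν i)

/-- The pointwise maximizer of the expected profit rate is the optimal price process. -/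
theorem isOptimalPrice_of_greedy [IsProbabilityMeasure μ] {F : BetFlow Ω n}
    (hF : M.IsBetFlow (fun i p u => l (p i) (u i)) F) (hg : IsGreedyPrice l g)
    (hu : ∀ s < M.T, ∀ ω i, u s ω i = g (M.P s ω i)) : M.IsOptimalPrice F u := by
  have hu0 := greedy_admissible hg hu
  have hsum : ∀ (ν : Measure Ω) [IsFiniteMeasure ν] (t : ℝ≥0) {v : PricePolicy Ω n},
      v ∈ M.admissible t → ∑ i, M.total t ν (gain l) v i ≠ ∞ := fun ν _ t v hv =>
    ENNReal.sum_ne_top.2 fun i _ => total_gain_ne_top hg hv ν i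
  have hopt : ∀ t < M.T, ∀ (x : ℝ) (q : Fin n → ℝ) (B : Set Ω), MeasurableSet[M.filt t] B →
      μ B ≠ 0 → M.objective F t x q B u = M.value F t x q B := by
    intro t ht x q B hB hB0
    have := cond_isProbabilityMeasure hB0
    have hut := admissible_mono hu0 t
    refine le_antisymm (le_iSup₂_of_le u hut le_rfl) (iSup₂_le fun v hv => ?_)
    refine (objective_le hF hg ht hv x q hB hB0).trans ?_
    rw [objective_greedy hF hg ht hu x q hB hB0, ereal_add_sub_le_iff (hsum _ _ hv)
      (hsum _ _ hut) (ENNReal.sum_ne_top.2 fun i _ => total_loss_ne_top hg hu _ i),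
      ← Finset.sum_add_distrib, ← Finset.sum_add_distrib]
    exact Finset.sum_le_sum fun i _ => total_gain_add_loss_le hg hu hv _ i
  refine ⟨hu0, hopt, fun t ht x q v hv hvV => ?_⟩
  have hut := admissible_mono hu0 t
  have hμ : μ[|univ] = μ := cond_univ μ
  have hμ0 : μ univ ≠ 0 := by simp
  have h1 := objective_le hF hg ht hv x q (B := univ) MeasurableSet.univ hμ0
  rw [hvV, ← hopt t ht x q univ MeasurableSet.univ hμ0,
    objective_greedy hF hg ht hu x q (B := univ) MeasurableSet.univ hμ0, hμ] at h1
  have hLu : ∀ i, M.total t μ (loss l) u i ≠ ∞ := fun i => total_loss_ne_top hg hu _ i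
  -- An infinite loss would make the upper bound for `v` equal to `⊥`, but the optimal value is
  -- finite.
  have hLv : ∑ i, M.total t μ (loss l) v i ≠ ∞ := by
    intro h
    rw [h] at h1
    have h2 : ∀ a : EReal, a - ((∞ : ℝ≥0∞) : EReal) = ⊥ := fun a => by simp [EReal.sub_top]
    rw [h2, le_bot_iff, ← EReal.coe_ennreal_toReal (hsum μ t hut),
      ← EReal.coe_ennreal_toReal (ENNReal.sum_ne_top.2 fun i _ => hLu i), ← EReal.coe_add,
      ← EReal.coe_sub] at h1
    exact EReal.coe_ne_bot _ h1
  rw [ereal_add_sub_le_iff (hsum _ _ hut) (hsum _ _ hv) hLv, ← Finset.sum_add_distrib,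
    ← Finset.sum_add_distrib] at h1
  have hfin : ∀ i, M.total t μ (gain l) v i + M.total t μ (loss l) u i ≠ ∞ := fun i =>
    ENNReal.add_ne_top.2 ⟨total_gain_ne_top hg hv μ i, hLu i⟩
  -- No event can do better than under `u`, so equality of the finite sums forces equality for each
  -- event, and below equality of the integrands almost everywhere.
  have heq := eq_of_sum_le_sum (fun i => total_gain_add_loss_le hg hu hv μ i)
    (ENNReal.sum_ne_top.2 fun i _ => hfin i) h1
  have hae : ∀ i, ∀ᵐ z ∂((timeMeasure t M.T).prod μ), v z.1 z.2 i = u z.1 z.2 i := by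
    intro i
    have hle := ae_gain_add_loss_le hg hu hv μ i
    have h2 := ae_eq_of_ae_le_of_lintegral_le hle
      (by rw [lintegral_gain_add_loss hg.measurable_rate hv u]; exact hfin i)
      ((aemeasurable_rate_prod hut (measurable_gain hg.measurable_rate) i μ).add
        (aemeasurable_rate_prod hv (measurable_loss hg.measurable_rate) i μ))
      (by rw [lintegral_gain_add_loss hg.measurable_rate hv u,
            lintegral_gain_add_loss hg.measurable_rate hut v, heq i])
    filter_upwards [h2, ae_prod_mem_Ico t M.T μ] with z h3 hz
    rw [hu _ hz.2] at h3 ⊢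
    exact hg.eq_of_eq _ (M.P_mem_Ioo _ hz.2 _ i) _ (hv.2 _ hz _ i) h3
  filter_upwards [ae_all_iff.2 hae] with z hz
  exact funext hz

/-! ### The value for constant conditional probabilities -/

section Constant

lemma total_of_const {p : Fin n → ℝ} (hp : ∀ s < M.T, ∀ ω, M.P s ω = p)
    (hu : ∀ s < M.T, ∀ ω i, u s ω i = g (M.P s ω i)) (ν : Measure Ω) [IsProbabilityMeasure ν]
    (φ : ℝ → ℝ → ℝ≥0∞) (i : Fin n) :
    M.total t ν φ u i = φ (p i) (g (p i)) * ENNReal.ofReal ((M.T : ℝ) - t) := by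
  have h : ∫⁻ z, φ (M.P z.1 z.2 i) (u z.1 z.2 i) ∂((timeMeasure t M.T).prod ν) =
      ∫⁻ _, φ (p i) (g (p i)) ∂((timeMeasure t M.T).prod ν) :=
    lintegral_congr_ae ((ae_prod_mem_Ico _ _ _).mono fun z hz => by
      dsimp only
      rw [hu _ hz.2, hp _ hz.2])
  rw [total, h, lintegral_const, ← univ_prod_univ, Measure.prod_prod, timeMeasure_univ,
    measure_univ, mul_one]

lemma real_outcome_of_const [IsProbabilityMeasure μ] (ht : t < M.T) {p : Fin n → ℝ}
    (hp : ∀ s < M.T, ∀ ω, M.P s ω = p) {B : Set Ω} (hB : MeasurableSet[M.filt t] B)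
    (hB0 : μ B ≠ 0) (i : Fin n) (hpi : 0 ≤ p i) : (μ[|B]).real (M.A i) = p i := by
  have := cond_isProbabilityMeasure hB0
  have h := (M.setLIntegral_outcome ht.le hB i (g := fun _ => 1) measurable_const).1
  simp only [hp t ht, mul_one, one_mul, lintegral_const, measure_univ,
    Measure.restrict_apply_univ] at h
  rw [Measure.real, h, ENNReal.toReal_ofReal hpi]

/-- The value function for constant conditional probabilities and a finite rate at the optimal
price. -/
lemma value_of_const [IsProbabilityMeasure μ] {F : BetFlow Ω n}
    (hF : M.IsBetFlow (fun i p u => l (p i) (u i)) F) (hg : IsGreedyPrice l g) {p : Fin n → ℝ}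
    (hp : ∀ s < M.T, ∀ ω, M.P s ω = p) (ht : t < M.T) (x : ℝ) (q : Fin n → ℝ) {B : Set Ω}
    (hB : MeasurableSet[M.filt t] B) (hB0 : μ B ≠ 0) {ρ : Fin n → ℝ} (hρ0 : ∀ i, 0 ≤ ρ i)
    (hρ : ∀ i, l (p i) (g (p i)) = ENNReal.ofReal (ρ i)) :
    M.value F t x q B = ((x - ∑ i, p i * q i +
      ((M.T : ℝ) - t) * ∑ i, (g (p i) - p i) * ρ i : ℝ) : EReal) := by
  have := cond_isProbabilityMeasure hB0
  have hpm : ∀ i, p i ∈ Ioo (0 : ℝ) 1 := by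
    intro i
    obtain ⟨ω⟩ := nonempty_of_isProbabilityMeasure μ
    have := M.P_mem_Ioo t ht ω i
    rwa [hp t ht] at this
  have hu : ∀ s < M.T, ∀ ω i, (fun _ _ i => g (p i) : PricePolicy Ω n) s ω i = g (M.P s ω i) :=
    fun s hs ω i => by rw [hp s hs]
  have hT : 0 ≤ (M.T : ℝ) - t := sub_nonneg.2 (by exact_mod_cast ht.le)
  have e1 : ∀ i, M.total t (μ[|B]) (gain l) (fun _ _ i => g (p i)) i =
      ENNReal.ofReal ((1 - p i) * (g (p i) * ρ i) * (M.T - t)) := by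
    intro i
    have h := hg.mem_Icc _ (hpm i)
    rw [total_of_const hp hu, gain_eq_ofReal (hpm i) h (hρ i), ← ENNReal.ofReal_mul]
    exact mul_nonneg (by linarith [(hpm i).2]) (mul_nonneg h.1 (hρ0 i))
  have e2 : ∀ i, M.total t (μ[|B]) (loss l) (fun _ _ i => g (p i)) i =
      ENNReal.ofReal (p i * ((1 - g (p i)) * ρ i) * (M.T - t)) := by
    intro i
    have h := hg.mem_Icc _ (hpm i)
    rw [total_of_const hp hu, loss_eq_ofReal (hpm i) h (hρ i), ← ENNReal.ofReal_mul]
    exact mul_nonneg (hpm i).1.le (mul_nonneg (by linarith [h.2]) (hρ0 i))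
  have n1 : ∀ i ∈ Finset.univ, 0 ≤ (1 - p i) * (g (p i) * ρ i) * (M.T - t) := fun i _ =>
    mul_nonneg (mul_nonneg (by linarith [(hpm i).2]) (mul_nonneg (hg.mem_Icc _ (hpm i)).1 (hρ0 i))) hT
  have n2 : ∀ i ∈ Finset.univ, 0 ≤ p i * ((1 - g (p i)) * ρ i) * (M.T - t) := fun i _ =>
    mul_nonneg (mul_nonneg (hpm i).1.le
      (mul_nonneg (by linarith [(hg.mem_Icc _ (hpm i)).2]) (hρ0 i))) hT
  rw [← (isOptimalPrice_of_greedy hF hg hu).optimal t ht x q B hB hB0,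
    objective_greedy hF hg ht hu x q hB hB0]
  simp_rw [e1, e2, fun i => real_outcome_of_const ht hp hB hB0 i (hpm i).1.le]
  rw [← ENNReal.ofReal_sum_of_nonneg n1, ← ENNReal.ofReal_sum_of_nonneg n2,
    EReal.coe_ennreal_ofReal, EReal.coe_ennreal_ofReal, max_eq_left (Finset.sum_nonneg n1),
    max_eq_left (Finset.sum_nonneg n2), ← EReal.coe_add, ← EReal.coe_sub, add_sub_assoc,
    ← Finset.sum_sub_distrib, Finset.mul_sum]
  refine congrArg (fun y : ℝ => ((x - ∑ i, p i * q i + y : ℝ) : EReal)) ?_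
  -- This is `(1 - p) g ρ - p (1 - g) ρ = (g - p) ρ`.
  exact Finset.sum_congr rfl fun i _ => by ring

end Constant

end BettingMarket

end Bookmaking

/-! ### The two rate functions in the betting market -/

theorem mainTheorem4 {Ω : Type*} [MeasurableSpace Ω] (μ : Measure Ω) [IsProbabilityMeasure μ]
    (n : ℕ) (M : Bookmaking.BettingMarket μ n) (F : Bookmaking.BetFlow Ω n) :
    (M.IsBetFlow (fun i p u => Bookmaking.oddsRate (p i) (u i)) F →
      M.IsOptimalPrice F (fun s ω i => √(M.P s ω i)) ∧
      ∀ p : Fin n → ℝ, (∀ s < M.T, ∀ ω, M.P s ω = p) →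
        M.IsOptimalPrice F (fun _ _ i => √(p i)) ∧
        ∀ t < M.T, ∀ (x : ℝ) (q : Fin n → ℝ) (B : Set Ω), MeasurableSet[M.filt t] B → μ B ≠ 0 →
          M.value F t x q B =
            ((x - ∑ i, p i * q i +
              ((M.T : ℝ) - t) * ∑ i, p i / (1 - p i) * (1 - √(p i)) ^ 2 : ℝ) : EReal)) ∧
    (M.IsBetFlow (fun i p u => Bookmaking.logRate (p i) (u i)) F →
      (∀ s < M.T, ∀ ω i,
        ∃! r : ℝ, r ∈ Ioo (Real.exp (-1)) 1 ∧ r * (1 + Real.log r) = M.P s ω i) ∧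
      ∀ u : Bookmaking.PricePolicy Ω n,
        (∀ s < M.T, ∀ ω i, u s ω i ∈ Ioo (Real.exp (-1)) 1 ∧
          u s ω i * (1 + Real.log (u s ω i)) = M.P s ω i) →
        M.IsOptimalPrice F u) := by
  open Bookmaking in
  refine ⟨fun hF => ⟨?_, fun p hp => ⟨?_, fun t ht x q B hB hB0 => ?_⟩⟩, fun hF => ⟨?_, ?_⟩⟩
  · exact BettingMarket.isOptimalPrice_of_greedy hF isGreedyPrice_oddsRate fun _ _ _ _ => rfl
  · refine BettingMarket.isOptimalPrice_of_greedy hF isGreedyPrice_oddsRate fun s hs ω i => ?_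
    rw [hp s hs]
  · have hpm : ∀ i, p i ∈ Ioo (0 : ℝ) 1 := by
      intro i
      obtain ⟨ω⟩ := nonempty_of_isProbabilityMeasure μ
      have := M.P_mem_Ioo t ht ω i
      rwa [hp t ht] at this
    have hs : ∀ i, 0 < √(p i) := fun i => Real.sqrt_pos.2 (hpm i).1
    rw [BettingMarket.value_of_const hF isGreedyPrice_oddsRate hp ht x q hB hB0
      (ρ := fun i => p i / (1 - p i) * ((1 - √(p i)) / √(p i))) (fun i => ?_)
      (fun i => oddsRate_eq_ofReal (hpm i) (hs i))]
    · refine congrArg (fun y : ℝ => ((x - ∑ i, p i * q i + (M.T - t) * y : ℝ) : EReal)) ?_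
      refine Finset.sum_congr rfl fun i _ => ?_
      -- The factor `√p` split off from `√p - p` cancels the denominator of the rate, leaving `(1 -
      -- √p)²`.
      have h1 := (Real.mul_self_sqrt (hpm i).1.le)
      have h2 : √(p i) - p i = √(p i) * (1 - √(p i)) := by linarith
      have h3 := (hs i).ne'
      rw [h2]
      field_simp
    · have h1 := hpm i
      have h2 : √(p i) ≤ 1 := Real.sqrt_le_one.2 h1.2.le
      exact mul_nonneg (div_nonneg h1.1.le (by linarith [h1.2]))
        (div_nonneg (by linarith) (hs i).le)
  · intro s hs ω i
    obtain ⟨r, hr, h⟩ := exists_mul_one_add_log_eq (M.P_mem_Ioo s hs ω i)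
    exact ⟨r, ⟨hr, h⟩, fun r' hr' => (logPrice_eq hr'.1 hr'.2).symm.trans (logPrice_eq hr h)⟩
  · intro u hu
    exact BettingMarket.isOptimalPrice_of_greedy hF isGreedyPrice_logRate fun s hs ω i =>
      (logPrice_eq (hu s hs ω i).1 (hu s hs ω i).2).symm
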